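/- Graphs are finite and may have loops and parallel edges. A circuit is a connected 2-regular subgraph. A circuit double cover of a graph $G$ is a multiset of circuits of $G$ such that every edge of $G$ lies in exactly two of its members (counted with multiplicity); $\nu(G)$ denotes the number of circuit double covers of $G$. A graph is cyclically $4$-edge-connected if every edge cut both of whose sides contain a circuit has at least $4$ edges. Let $G$ be a cyclically $4$-edge-connected cubic graph other than $K_4$ (equivalently, with $|V(G)| \neq 4$), and let $v_0v_1v_2v_3$ be a 4-cycle in $G$ with edges $e_i = v_iv_{i+1}$ (indices modulo $4$). Let $G_1$ be the graph obtained from $G - \{e_0, e_2\}$, and $G_2$ the graph obtained from $G - \{e_1, e_3\}$, by suppressing all vertices of degree $2$. Then $$\nu(G) \ge 4 \min\{\nu(G_1), \nu(G_2)\}.$$ -/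

import Mathlib

/-!
Finite multigraphs (loops and parallel edges allowed) are Mathlib's `Graph α β`; `H ≤ G` is the
subgraph order.
-/

namespace Graph

/-- The degree of a vertex, a loop being counted twice. -/
noncomputable def deg {α β : Type*} (G : Graph α β) (x : α) : ℕ∞ :=
  (G.incidenceSet x).encard + (G.loopSet x).encard

/-- Every vertex has degree three. -/
def IsCubic {α β : Type*} (G : Graph α β) : Prop :=
  ∀ x ∈ G.vertexSet, G.deg x = 3

/-- `G` has a vertex, and any two vertices are joined by a walk. -/
def IsConnected {α β : Type*} (G : Graph α β) : Prop :=
  G.vertexSet.Nonempty ∧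
    ∀ x ∈ G.vertexSet, ∀ y ∈ G.vertexSet, Relation.ReflTransGen G.Adj x y

/-- A circuit: a finite connected 2-regular graph, i.e. a cycle `C_k` with `k ≥ 1`. -/
def IsCircuit {α β : Type*} (C : Graph α β) : Prop :=
  C.vertexSet.Finite ∧ C.IsConnected ∧ ∀ x ∈ C.vertexSet, C.deg x = 2

open Classical in
/-- A circuit double cover of `G`: a multiset of circuits of `G` such that every edge of `G`
lies in exactly two members, counted with multiplicity. -/
def IsCircuitDoubleCover {α β : Type*} (G : Graph α β) (𝒞 : Multiset (Graph α β)) : Prop :=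
  (∀ C ∈ 𝒞, C ≤ G ∧ C.IsCircuit) ∧
    ∀ e ∈ G.edgeSet, 𝒞.countP (fun C => e ∈ C.edgeSet) = 2

/-- The number of circuit double covers of `G` (a natural number whenever `G` is finite). -/
noncomputable def nu {α β : Type*} (G : Graph α β) : ℕ∞ :=
  {𝒞 : Multiset (Graph α β) | G.IsCircuitDoubleCover 𝒞}.encard

/-- The edge cut between a set `X` of vertices and its complement. -/
def edgeCut {α β : Type*} (G : Graph α β) (X : Set α) : Set β :=
  {e | ∃ x ∈ X, ∃ y ∈ G.vertexSet \ X, G.IsLink e x y}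

/-- Every edge cut that has a circuit on each of its two sides has at least `k` edges. -/
def IsCyclicallyEdgeConnected {α β : Type*} (G : Graph α β) (k : ℕ) : Prop :=
  ∀ X ⊆ G.vertexSet,
    (∃ C : Graph α β, C ≤ G.induce X ∧ C.IsCircuit) →
    (∃ C : Graph α β, C ≤ G.induce (G.vertexSet \ X) ∧ C.IsCircuit) →
    (k : ℕ∞) ≤ (G.edgeCut X).encard

/-- `H'` arises from `H` by suppressing one vertex `v` of degree two that lies on two different
edges `e = vx` and `f = vy`: the vertex `v` and both edges are removed and a new edge joining
`x` and `y` is added (a loop if `x = y`). The new edge reuses the label `e`. -/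
def SuppressStep {α β : Type*} (H H' : Graph α β) : Prop :=
  ∃ (v x y : α) (e f : β), H.deg v = 2 ∧ e ≠ f ∧ H.IsLink e v x ∧ H.IsLink f v y ∧
    H'.vertexSet = H.vertexSet \ {v} ∧
    ∀ (g : β) (a b : α), H'.IsLink g a b ↔
      (g = e ∧ ((a = x ∧ b = y) ∨ (a = y ∧ b = x))) ∨ (g ≠ e ∧ g ≠ f ∧ H.IsLink g a b)

/-- `H'` arises from `H` by suppressing vertices of degree two, one after another, until there
are none left. -/
def IsSuppressionOf {α β : Type*} (H' H : Graph α β) : Prop :=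
  Relation.ReflTransGen SuppressStep H H' ∧ ∀ v ∈ H'.vertexSet, H'.deg v ≠ 2

/-- The vertices `v 0, v 1, v 2, v 3` are different and, in this cyclic order, joined by the
edges `e 0, e 1, e 2, e 3` of `G`; thus `e 0, e 2` and `e 1, e 3` are the pairs of opposite
edges. -/
def IsFourCycle {α β : Type*} (G : Graph α β) (v : Fin 4 → α) (e : Fin 4 → β) : Prop :=
  Function.Injective v ∧ ∀ i : Fin 4, G.IsLink (e i) (v i) (v (i + 1))

end Graph

/-!
The edge sets of circuits are the minimal nonempty elements of the binary cycle space, so double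
covers can be counted in terms of edge sets alone, and suppressing a vertex of degree two does not
change their number. Off the 4-cycle, a double cover of `G`, of `G - {e 0, e 2}` or of
`G - {e 1, e 3}` splits into circuits and four paths whose ends are the `v i`, each `v i` being an
end of two of them. The covers are compared separately for each such family of strands: up to
labelling there are six ways to distribute the ends of the paths, a cover of `G - {e 0, e 2}` or
`G - {e 1, e 3}` is determined by which paths it joins, and, whichever pairs of paths are disjoint,
a finite check shows that the same strands extend to at least twice as many double covers of `G` as
of the two subgraphs together. Summing over the families of strands gives
`2 * (ν(G₁) + ν(G₂)) ≤ ν(G)`.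

This needs a 4-cycle without chords. A chord would leave an edge cut of size at most two around the
4-cycle; as `G` is cubic and has further vertices, there is a circuit on the other side of this
cut, contradicting cyclic connectivity. A loop of `G` gives rise to a bridge, so that `G₁` and `G₂`
have no double cover.
-/

section

open scoped Classical

namespace CycleSpace

variable {α β : Type*}

/-! ### Even edge sets -/

/-- The mod-2 boundary at the vertex `x` of a finite edge set `F`, for an incidence relation `I`.
For multigraphs `I` is nonloop incidence, so that loops do not contribute. -/
noncomputable def boundary (I : β → α → Prop) (F : Finset β) (x : α) : ZMod 2 :=
  ∑ g ∈ F, if I g x then 1 else 0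

/-- Membership in the binary cycle space. -/
def IsEven (I : β → α → Prop) (F : Finset β) : Prop :=
  ∀ x, boundary I F x = 0

/-- The edge sets of circuits: minimal nonempty elements of the binary cycle space. -/
def IsCircuitSet (I : β → α → Prop) : Finset β → Prop :=
  Minimal fun F => F.Nonempty ∧ IsEven I F

/-- The edge `g` joins two distinct vertices. -/
def HasEnds (I : β → α → Prop) (g : β) : Prop :=
  ∃ x y, x ≠ y ∧ ∀ z, I g z ↔ z = x ∨ z = y

/-- The vertex `x` has degree three, and `a`, `b`, `c` are the edges at `x`. -/
structure IsClaw (I : β → α → Prop) (x : α) (a b c : β) : Prop where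
  ne₁₂ : a ≠ b
  ne₁₃ : a ≠ c
  ne₂₃ : b ≠ c
  inc_iff : ∀ g, I g x ↔ g = a ∨ g = b ∨ g = c

variable {I : β → α → Prop} {F F' : Finset β} {x y : α}

lemma zmod_two_eq_zero_or_one (a : ZMod 2) : a = 0 ∨ a = 1 := by
  revert a; decide

@[simp] lemma boundary_empty : boundary I ∅ x = 0 :=
  Finset.sum_empty

lemma boundary_singleton (g : β) : boundary I {g} x = if I g x then 1 else 0 :=
  Finset.sum_singleton _ _

lemma boundary_union (h : Disjoint F F') :
    boundary I (F ∪ F') x = boundary I F x + boundary I F' x :=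
  Finset.sum_union h

lemma boundary_sdiff (h : F' ⊆ F) :
    boundary I (F \ F') x = boundary I F x + boundary I F' x := by
  have hsum : boundary I (F \ F') x + boundary I F' x = boundary I F x := Finset.sum_sdiff h
  rw [← hsum, add_assoc, CharTwo.add_self_eq_zero, add_zero]

lemma boundary_eq_zero_of_forall_not (hx : ∀ g ∈ F, ¬ I g x) : boundary I F x = 0 :=
  Finset.sum_eq_zero fun g hg => if_neg (hx g hg)

lemma boundary_congr {J : β → α → Prop} (h : ∀ g ∈ F, I g x ↔ J g x) :
    boundary I F x = boundary J F x :=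
  Finset.sum_congr rfl fun g hg => if_congr (h g hg) rfl rfl

lemma IsEven.sdiff (hF : IsEven I F) (hF' : IsEven I F') (h : F' ⊆ F) : IsEven I (F \ F') :=
  fun x => by rw [boundary_sdiff h, hF x, hF' x, add_zero]

lemma HasEnds.exists_other_end {g : β} (hg : HasEnds I g) (hx : I g x) :
    ∃ z, z ≠ x ∧ ∀ w, I g w ↔ w = x ∨ w = z := by
  obtain ⟨a, b, hab, hinc⟩ := hg
  rcases (hinc x).1 hx with rfl | rfl
  · exact ⟨b, hab.symm, hinc⟩
  · exact ⟨a, hab, fun w => by rw [hinc w, or_comm]⟩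

lemma exists_path_of_boundary_eq_one (hF : ∀ g ∈ F, HasEnds I g) (hx : boundary I F x = 1) :
    ∃ y, y ≠ x ∧ boundary I F y = 1 ∧
      ∃ P ⊆ F, ∀ z, boundary I P z = if z = x ∨ z = y then 1 else 0 := by
  induction hn : F.card using Nat.strong_induction_on generalizing F x with
  | _ n ih =>
  obtain ⟨g, hg, hgx⟩ : ∃ g ∈ F, I g x := by
    by_contra! hnone
    exact zero_ne_one ((boundary_eq_zero_of_forall_not hnone).symm.trans hx)
  obtain ⟨z, hzx, hz⟩ := (hF g hg).exists_other_end hgx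
  have hgbd (w : α) : boundary I {g} w = if w = x ∨ w = z then 1 else 0 := by
    rw [boundary_singleton, if_congr (hz w) rfl rfl]
  rcases zmod_two_eq_zero_or_one (boundary I F z) with hz0 | hz1
  · have herase (w : α) : boundary I (F.erase g) w = boundary I F w + boundary I {g} w := by
      rw [Finset.erase_eq, boundary_sdiff (by simpa using hg)]
    obtain ⟨y, hyz, hy, P, hPF, hP⟩ := ih _ (hn ▸ Finset.card_erase_lt_of_mem hg)
      (fun k hk => hF k (Finset.mem_of_mem_erase hk)) (x := z)
      (by rw [herase, hgbd, hz0]; simp) rfl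
    have hyx : y ≠ x := by
      rintro rfl
      simp [herase, hgbd, hx, CharTwo.add_self_eq_zero] at hy
    have hgP : g ∉ P := fun h => Finset.notMem_erase g F (hPF h)
    refine ⟨y, hyx, by simpa [herase, hgbd, hyx, hyz] using hy, insert g P,
      Finset.insert_subset hg (hPF.trans (Finset.erase_subset _ _)), fun w => ?_⟩
    rw [Finset.insert_eq, boundary_union (Finset.disjoint_singleton_left.2 hgP), hgbd, hP]
    by_cases hwz : w = z
    · simp [hwz, hzx, hyz.symm, CharTwo.add_self_eq_zero]
    · by_cases hwx : w = x <;> simp [hwx, hwz, hzx.symm, hyx.symm]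
  · exact ⟨z, hzx, hz1, {g}, Finset.singleton_subset_iff.2 hg, hgbd⟩

lemma exists_minimal_nonempty_mem {Q : Finset β → Prop} {g : β}
    (hQ : ∀ F P, Q F → Q P → P ⊆ F → Q (F \ P)) (hF : Q F) (hg : g ∈ F) :
    ∃ P ⊆ F, g ∈ P ∧ Minimal (fun P => P.Nonempty ∧ Q P) P := by
  induction hn : F.card using Nat.strong_induction_on generalizing F with
  | _ n ih =>
  obtain ⟨P, hPF, hP⟩ := exists_minimal_le_of_wellFoundedLT (fun P => P.Nonempty ∧ Q P) F
    ⟨⟨g, hg⟩, hF⟩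
  by_cases hgP : g ∈ P
  · exact ⟨P, hPF, hgP, hP⟩
  · obtain ⟨P', hP'F, hgP', hP'⟩ := ih _
      (hn ▸ Finset.card_lt_card (Finset.sdiff_ssubset hPF hP.prop.1))
      (hQ F P hF hP.prop.2 hPF) (Finset.mem_sdiff.2 ⟨hg, hgP⟩) rfl
    exact ⟨P', hP'F.trans Finset.sdiff_subset, hgP', hP'⟩

lemma countP_le_countP {p q : β → Prop} [DecidablePred p] [DecidablePred q] (D : Multiset β)
    (h : ∀ g, p g → q g) : D.countP p ≤ D.countP q := by
  rw [Multiset.countP_eq_card_filter, Multiset.countP_eq_card_filter]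
  exact Multiset.card_le_card (Multiset.monotone_filter_right D h)

namespace IsClaw

variable {a b c : β}

lemma rotate (h : IsClaw I x a b c) : IsClaw I x b c a where
  ne₁₂ := h.ne₂₃
  ne₁₃ := h.ne₁₂.symm
  ne₂₃ := h.ne₁₃.symm
  inc_iff g := by rw [h.inc_iff]; tauto

lemma swap (h : IsClaw I x a b c) : IsClaw I x a c b where
  ne₁₂ := h.ne₁₃
  ne₁₃ := h.ne₁₂
  ne₂₃ := h.ne₂₃.symm
  inc_iff g := by rw [h.inc_iff, or_comm (a := g = b)]

lemma exists_of_inc {g : β} (h : IsClaw I x a b c) (hg : I g x) : ∃ a b, IsClaw I x g a b := by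
  rcases (h.inc_iff g).1 hg with rfl | rfl | rfl
  · exact ⟨b, c, h⟩
  · exact ⟨c, a, h.rotate⟩
  · exact ⟨a, b, h.rotate.rotate⟩

lemma boundary_eq (h : IsClaw I x a b c) (F : Finset β) :
    boundary I F x =
      (if a ∈ F then 1 else 0) + (if b ∈ F then 1 else 0) + (if c ∈ F then 1 else 0) := by
  have hsplit (g : β) : (if I g x then (1 : ZMod 2) else 0) =
      (if g = a then 1 else 0) + (if g = b then 1 else 0) + (if g = c then 1 else 0) := by
    rw [if_congr (h.inc_iff g) rfl rfl]
    have := h.ne₁₂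
    have := h.ne₁₃
    have := h.ne₂₃
    by_cases hga : g = a <;> by_cases hgb : g = b <;> by_cases hgc : g = c <;> simp_all
  simp only [boundary, hsplit, Finset.sum_add_distrib, Finset.sum_ite_eq']

lemma boundary_eq_zero_iff (h : IsClaw I x a b c) :
    boundary I F x = 0 ↔ (a ∈ F → (b ∈ F ↔ c ∉ F)) ∧ (a ∉ F → (b ∈ F ↔ c ∈ F)) := by
  rw [h.boundary_eq]
  by_cases ha : a ∈ F <;> by_cases hb : b ∈ F <;> by_cases hc : c ∈ F <;>
    simp [ha, hb, hc, CharTwo.add_self_eq_zero]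

lemma boundary_inter_eq_zero {W P : Finset β} (h : IsClaw I x a b c)
    (hW : boundary I W x = 0) (hP : boundary I P x = 0) (hF : boundary I F x = 0)
    (hPW : P ⊆ W) (hFW : F ⊆ W) : boundary I (P ∩ F) x = 0 := by
  rw [h.boundary_eq_zero_iff] at hW hP hF ⊢
  have haP := @hPW a
  have hbP := @hPW b
  have hcP := @hPW c
  have haF := @hFW a
  have hbF := @hFW b
  have hcF := @hFW c
  clear hPW hFW h
  simp only [Finset.mem_inter]
  by_cases a ∈ P <;> by_cases b ∈ P <;> by_cases c ∈ P <;> simp_all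

lemma countP_add_countP (h : IsClaw I x a b c) (D : Multiset (Finset β))
    (hD : ∀ F ∈ D, boundary I F x = 0) :
    D.countP (a ∈ ·) + D.countP (b ∈ ·) =
      D.countP (c ∈ ·) + 2 * D.countP (fun F => a ∈ F ∧ b ∈ F) := by
  induction D using Multiset.induction with
  | empty => simp
  | cons F D ih =>
    have hDsum := ih fun F hF => hD F (Multiset.mem_cons_of_mem hF)
    have hF := h.boundary_eq_zero_iff.1 (hD F (Multiset.mem_cons_self F D))
    simp only [Multiset.countP_cons]
    by_cases ha : a ∈ F <;> by_cases hb : b ∈ F <;> by_cases hc : c ∈ F <;>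
      simp [ha, hb, hc] at hF ⊢ <;> omega

lemma countP_pair (h : IsClaw I x a b c) {D : Multiset (Finset β)}
    (hD : ∀ F ∈ D, IsEven I F) (hx : ∀ g, I g x → D.countP (g ∈ ·) = 2) :
    D.countP (fun F => a ∈ F ∧ b ∈ F) = 1 := by
  have hsum := h.countP_add_countP D fun F hF => hD F hF x
  rw [hx a ((h.inc_iff a).2 (by simp)), hx b ((h.inc_iff b).2 (by simp)),
    hx c ((h.inc_iff c).2 (by simp))] at hsum
  omega

end IsClaw

/-- Double covers of the edge set `E` by edge sets of circuits. -/
def IsDoubleCover (I : β → α → Prop) (E : Set β) (D : Multiset (Finset β)) : Prop :=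
  (∀ F ∈ D, ↑F ⊆ E ∧ IsCircuitSet I F) ∧ ∀ g ∈ E, D.countP (g ∈ ·) = 2

/-- The double covers of a finite edge set `E` by pairwise different edge sets of circuits. -/
noncomputable def covers (I : β → α → Prop) (E : Finset β) : Finset (Finset (Finset β)) :=
  E.powerset.powerset.filter fun D => IsDoubleCover I E D.val

lemma IsDoubleCover.isEven {E : Set β} {D : Multiset (Finset β)} (hD : IsDoubleCover I E D) :
    ∀ F ∈ D, IsEven I F :=
  fun F hF => (hD.1 F hF).2.prop.2

lemma mem_covers {E : Finset β} {D : Finset (Finset β)} :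
    D ∈ covers I E ↔ IsDoubleCover I E D.val := by
  simp only [covers, Finset.mem_filter, Finset.mem_powerset, and_iff_right_iff_imp]
  exact fun h F hF => Finset.mem_powerset.2 (Finset.coe_subset.1 (h.1 F hF).1)

lemma card_filter_mem_eq_two {E : Finset β} {D : Finset (Finset β)} {g : β}
    (hD : D ∈ covers I E) (hg : g ∈ E) : (D.filter (g ∈ ·)).card = 2 := by
  rw [← (mem_covers.1 hD).2 g hg, Multiset.countP_eq_card_filter]
  rfl

/-! ### Strands off a 4-cycle -/

/-- A 4-cycle `v 0, v 1, v 2, v 3` with edges `e i = v i v (i + 1)` and without chords in a loopless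
cubic graph with edge set `E`; the third edge at `v i` is `f i`. Points incident with no edge
stand for elements of the ambient type that are not vertices. -/
structure Square (I : β → α → Prop) (E : Finset β) where
  v : Fin 4 → α
  e : Fin 4 → β
  f : Fin 4 → β
  v_injective : Function.Injective v
  f_injective : Function.Injective f
  claw_v : ∀ i, IsClaw I (v i) (e i) (e (i - 1)) (f i)
  claw_outer : ∀ x ∉ Set.range v, (∀ g, ¬ I g x) ∨ ∃ a b c, IsClaw I x a b c
  hasEnds : ∀ g ∈ E, HasEnds I g
  mem_of_inc : ∀ g x, I g x → g ∈ E

namespace Square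

variable {E E' P W C : Finset β} {D : Finset (Finset β)} {g : β} {i : Fin 4}

/-- The edge set `F` avoids the 4-cycle and is even at all vertices outside it. -/
structure IsOuterEven (S : Square I E) (F : Finset β) : Prop where
  subset : F ⊆ E
  e_notMem : ∀ i, S.e i ∉ F
  boundary_eq_zero : ∀ x ∉ Set.range S.v, boundary I F x = 0

/-- Minimal nonempty outer even sets: circuits avoiding the 4-cycle, and paths with both ends
on it. -/
def IsStrand (S : Square I E) : Finset β → Prop :=
  Minimal fun F => F.Nonempty ∧ S.IsOuterEven F

/-- The strands contained in the members of `D`. -/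
noncomputable def strands (S : Square I E) (D : Finset (Finset β)) : Finset (Finset β) :=
  E.powerset.filter fun F => S.IsStrand F ∧ ∃ C ∈ D, F ⊆ C

/-- The indices `i` such that the strand `F` ends at `v i`. -/
noncomputable def endsOf (S : Square I E) (F : Finset β) : Finset (Fin 4) :=
  Finset.univ.filter fun i => S.f i ∈ F

/-- Families of strands that cover every edge off the 4-cycle exactly twice. -/
structure IsStrandCover (S : Square I E) (O : Finset (Finset β)) : Prop where
  isStrand : ∀ F ∈ O, S.IsStrand F
  card_eq_two : ∀ g ∈ E, g ∉ Set.range S.e → (O.filter (g ∈ ·)).card = 2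

/-- The subset `E'` of `E` contains every edge off the 4-cycle. -/
structure ContainsOuter (S : Square I E) (E' : Finset β) : Prop where
  subset : E' ⊆ E
  mem : ∀ g ∈ E, g ∉ Set.range S.e → g ∈ E'

lemma mem_strands (S : Square I E) : F ∈ S.strands D ↔ S.IsStrand F ∧ ∃ C ∈ D, F ⊆ C := by
  simp only [strands, Finset.mem_filter, Finset.mem_powerset, and_iff_right_iff_imp]
  exact fun h => h.1.prop.2.subset

@[simp] lemma mem_endsOf (S : Square I E) : i ∈ S.endsOf F ↔ S.f i ∈ F := by
  simp [endsOf]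

lemma inc_e_v (S : Square I E) (i : Fin 4) : I (S.e i) (S.v i) :=
  ((S.claw_v i).inc_iff _).2 (Or.inl rfl)

lemma inc_e_v_succ (S : Square I E) (i : Fin 4) : I (S.e i) (S.v (i + 1)) :=
  ((S.claw_v (i + 1)).inc_iff _).2 (Or.inr (Or.inl (by rw [add_sub_cancel_right])))

lemma inc_f_v (S : Square I E) (i : Fin 4) : I (S.f i) (S.v i) :=
  ((S.claw_v i).inc_iff _).2 (Or.inr (Or.inr rfl))

lemma e_mem (S : Square I E) (i : Fin 4) : S.e i ∈ E :=
  S.mem_of_inc _ _ (S.inc_e_v i)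

lemma f_mem (S : Square I E) (i : Fin 4) : S.f i ∈ E :=
  S.mem_of_inc _ _ (S.inc_f_v i)

lemma inc_e_iff (S : Square I E) (i : Fin 4) (x : α) :
    I (S.e i) x ↔ x = S.v i ∨ x = S.v (i + 1) := by
  have hne : S.v (i + 1) ≠ S.v i := S.v_injective.ne (by revert i; decide)
  obtain ⟨z, -, hz⟩ := (S.hasEnds _ (S.e_mem i)).exists_other_end (S.inc_e_v i)
  rw [hz, ((hz _).1 (S.inc_e_v_succ i)).resolve_left hne]

lemma e_injective (S : Square I E) : Function.Injective S.e := by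
  intro i j hij
  have hi := (S.inc_e_iff j _).1 (hij ▸ S.inc_e_v i)
  have hi' := (S.inc_e_iff j _).1 (hij ▸ S.inc_e_v_succ i)
  simp only [S.v_injective.eq_iff] at hi hi'
  clear hij
  revert i j; decide

lemma e_ne_f (S : Square I E) (i j : Fin 4) : S.e i ≠ S.f j := by
  intro hij
  rcases (S.inc_e_iff i _).1 (hij ▸ S.inc_f_v j) with hj | hj <;> obtain rfl := S.v_injective hj
  · exact (S.claw_v j).ne₁₃ hij
  · exact (S.claw_v (i + 1)).ne₂₃ (by rw [add_sub_cancel_right, hij])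

lemma f_notMem_range_e (S : Square I E) (i : Fin 4) : S.f i ∉ Set.range S.e :=
  fun ⟨j, hj⟩ => S.e_ne_f j i hj

lemma notMem_range_e_of_inc (S : Square I E) (hx : x ∉ Set.range S.v) (hg : I g x) :
    g ∉ Set.range S.e := by
  rintro ⟨i, rfl⟩
  rcases (S.inc_e_iff i x).1 hg with rfl | rfl <;> exact hx ⟨_, rfl⟩

lemma exists_outer_inc (S : Square I E) (hg : g ∈ E) (hge : g ∉ Set.range S.e) :
    ∃ x ∉ Set.range S.v, I g x := by
  obtain ⟨a, b, hab, hinc⟩ := S.hasEnds g hg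
  have eq_f (i : Fin 4) (hi : I g (S.v i)) : g = S.f i := by
    rcases ((S.claw_v i).inc_iff g).1 hi with rfl | rfl | rfl
    · exact absurd ⟨i, rfl⟩ hge
    · exact absurd ⟨i - 1, rfl⟩ hge
    · rfl
  by_contra! hin
  obtain ⟨i, rfl⟩ : a ∈ Set.range S.v := not_imp_comm.1 (hin a) (not_not.2 ((hinc a).2 (.inl rfl)))
  obtain ⟨j, rfl⟩ : b ∈ Set.range S.v := not_imp_comm.1 (hin b) (not_not.2 ((hinc b).2 (.inr rfl)))
  have hij := (eq_f i ((hinc _).2 (.inl rfl))).symm.trans (eq_f j ((hinc _).2 (.inr rfl)))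
  exact hab (congrArg S.v (S.f_injective hij))

lemma exists_outer_claw (S : Square I E) (hg : g ∈ E) (hge : g ∉ Set.range S.e) :
    ∃ x ∉ Set.range S.v, ∃ a b, IsClaw I x g a b := by
  obtain ⟨x, hx, hgx⟩ := S.exists_outer_inc hg hge
  obtain hnone | ⟨a, b, c, hclaw⟩ := S.claw_outer x hx
  · exact absurd hgx (hnone g)
  · exact ⟨x, hx, hclaw.exists_of_inc hgx⟩

namespace IsOuterEven

variable {S : Square I E}

lemma notMem_range_e (hF : S.IsOuterEven F) (hg : g ∈ F) : g ∉ Set.range S.e := by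
  rintro ⟨i, rfl⟩
  exact hF.e_notMem i hg

lemma mono (hF : S.IsOuterEven F) (hF' : F' ⊆ F)
    (h : ∀ x ∉ Set.range S.v, boundary I F' x = 0) : S.IsOuterEven F' :=
  ⟨hF'.trans hF.subset, fun i hi => hF.e_notMem i (hF' hi), h⟩

lemma sdiff (hF : S.IsOuterEven F) (hF' : S.IsOuterEven F') (h : F' ⊆ F) :
    S.IsOuterEven (F \ F') :=
  hF.mono Finset.sdiff_subset fun x hx => by
    rw [boundary_sdiff h, hF.boundary_eq_zero x hx, hF'.boundary_eq_zero x hx, add_zero]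

lemma boundary_v (hF : S.IsOuterEven F) (i : Fin 4) :
    boundary I F (S.v i) = if i ∈ S.endsOf F then 1 else 0 := by
  simp [(S.claw_v i).boundary_eq, hF.e_notMem]

lemma isEven (hF : S.IsOuterEven F) (h : S.endsOf F = ∅) : IsEven I F := by
  intro x
  by_cases hx : x ∈ Set.range S.v
  · obtain ⟨i, rfl⟩ := hx
    simp [hF.boundary_v, h]
  · exact hF.boundary_eq_zero x hx

end IsOuterEven

lemma isOuterEven_sdiff (S : Square I E) (hE : F ⊆ E) (hF : IsEven I F) :
    S.IsOuterEven (F \ Finset.univ.image S.e) := by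
  refine ⟨Finset.sdiff_subset.trans hE, fun i => by simp, fun x hx => ?_⟩
  rw [← Finset.sdiff_inter_self_left, boundary_sdiff Finset.inter_subset_left, hF x, zero_add]
  refine boundary_eq_zero_of_forall_not fun g hg hgx => S.notMem_range_e_of_inc hx hgx ?_
  simpa using (Finset.mem_inter.1 hg).2

namespace IsStrand

variable {S : Square I E}

lemma eq_of_subset (hP : S.IsStrand P) (hF : F.Nonempty) (hFo : S.IsOuterEven F) (h : F ⊆ P) :
    F = P :=
  Minimal.eq_of_le hP ⟨hF, hFo⟩ h

lemma subset_or_disjoint (hP : S.IsStrand P) (hPW : P ⊆ W) (hFW : F ⊆ W)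
    (hW : ∀ x ∉ Set.range S.v, boundary I W x = 0)
    (hF : ∀ x ∉ Set.range S.v, boundary I F x = 0) : P ⊆ F ∨ Disjoint P F := by
  have hout : S.IsOuterEven (P ∩ F) := hP.prop.2.mono Finset.inter_subset_left fun x hx => by
    rcases S.claw_outer x hx with hnone | ⟨a, b, c, hclaw⟩
    · exact boundary_eq_zero_of_forall_not fun g _ => hnone g
    · exact hclaw.boundary_inter_eq_zero (hW x hx) (hP.prop.2.boundary_eq_zero x hx) (hF x hx)
        hPW hFW
  rcases (P ∩ F).eq_empty_or_nonempty with hempty | hne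
  · exact Or.inr (Finset.disjoint_iff_inter_eq_empty.2 hempty)
  · exact Or.inl (Finset.inter_eq_left.1 (hP.eq_of_subset hne hout Finset.inter_subset_left))

lemma eq_or_disjoint (hP : S.IsStrand P) (hF : S.IsStrand F) (hPW : P ⊆ W) (hFW : F ⊆ W)
    (hW : ∀ x ∉ Set.range S.v, boundary I W x = 0) : P = F ∨ Disjoint P F :=
  (hP.subset_or_disjoint hPW hFW hW hF.prop.2.boundary_eq_zero).imp_left
    (hF.eq_of_subset hP.prop.1 hP.prop.2)

lemma exists_endsOf_eq (hP : S.IsStrand P) (hi : i ∈ S.endsOf P) :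
    ∃ j, j ≠ i ∧ S.endsOf P = {i, j} := by
  have hP' := hP.prop.2
  obtain ⟨y, hy, hyP, F, hFP, hF⟩ := exists_path_of_boundary_eq_one (x := S.v i)
    (fun g hg => S.hasEnds g (hP'.subset hg)) (by rw [hP'.boundary_v, if_pos hi])
  obtain ⟨j, rfl⟩ : y ∈ Set.range S.v := by
    by_contra hy'
    exact zero_ne_one ((hP'.boundary_eq_zero y hy').symm.trans hyP)
  have hFo : S.IsOuterEven F := hP'.mono hFP fun x hx => by
    rw [hF, if_neg]
    rintro (rfl | rfl) <;> exact hx ⟨_, rfl⟩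
  have hne : F.Nonempty := by
    rw [Finset.nonempty_iff_ne_empty]
    rintro rfl
    simpa using hF (S.v i)
  obtain rfl := hP.eq_of_subset hne hFo hFP
  refine ⟨j, ne_of_apply_ne S.v hy, Finset.ext fun k => ?_⟩
  have hk := (hFo.boundary_v k).symm.trans (hF (S.v k))
  simp only [S.v_injective.eq_iff] at hk
  by_cases hk' : k = i ∨ k = j <;> by_cases hkF : k ∈ S.endsOf F <;> simp_all

lemma isCircuitSet (hP : S.IsStrand P) (h : S.endsOf P = ∅) : IsCircuitSet I P :=
  ⟨⟨hP.prop.1, hP.prop.2.isEven h⟩, fun _ hF hFP =>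
    (hP.eq_of_subset hF.1 (hP.prop.2.mono hFP fun x _ => hF.2 x) hFP).ge⟩

end IsStrand

lemma exists_isStrand_mem (S : Square I E) (hCE : C ⊆ E) (hC : IsEven I C) (hg : g ∈ C)
    (hge : g ∉ Set.range S.e) : ∃ P ⊆ C, g ∈ P ∧ S.IsStrand P := by
  obtain ⟨P, hPC, hgP, hP⟩ := exists_minimal_nonempty_mem (g := g) (Q := S.IsOuterEven)
    (fun F P hF hP hPF => hF.sdiff hP hPF) (S.isOuterEven_sdiff hCE hC)
    (by simpa [hg] using hge)
  exact ⟨P, hPC.trans Finset.sdiff_subset, hgP, hP⟩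

lemma countP_superset_le_one {S : Square I E} (hE' : S.ContainsOuter E')
    {D : Multiset (Finset β)} (hD : IsDoubleCover I E' D) (hgP : g ∈ P) (hg : g ∈ E)
    (hge : g ∉ Set.range S.e) (hP : ∀ x ∉ Set.range S.v, boundary I P x = 0) :
    D.countP (P ⊆ ·) ≤ 1 := by
  obtain ⟨x, hx, a, b, hclaw⟩ := S.exists_outer_claw hg hge
  have htwo (k : β) (hk : I k x) : D.countP (k ∈ ·) = 2 :=
    hD.2 k (hE'.mem k (S.mem_of_inc k x hk) (S.notMem_range_e_of_inc hx hk))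
  have hab : a ∈ P ∨ b ∈ P := by
    have := (hclaw.boundary_eq_zero_iff.1 (hP x hx)).1 hgP
    tauto
  rcases hab with haP | hbP
  · rw [← hclaw.countP_pair hD.isEven htwo]
    exact countP_le_countP D fun C hC => ⟨hC hgP, hC haP⟩
  · rw [← hclaw.swap.countP_pair hD.isEven htwo]
    exact countP_le_countP D fun C hC => ⟨hC hgP, hC hbP⟩

lemma eq_of_isStrand_subset {S : Square I E} (hE' : S.ContainsOuter E') (hD : D ∈ covers I E')
    (hP : S.IsStrand P) {C C' : Finset β} (hC : C ∈ D) (hC' : C' ∈ D) (hPC : P ⊆ C)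
    (hPC' : P ⊆ C') : C = C' := by
  obtain ⟨g, hg⟩ := hP.prop.1
  have hle := countP_superset_le_one hE' (mem_covers.1 hD) hg (hP.prop.2.subset hg)
    (hP.prop.2.notMem_range_e hg) hP.prop.2.boundary_eq_zero
  rw [Multiset.countP_eq_card_filter] at hle
  change (D.filter (P ⊆ ·)).card ≤ 1 at hle
  exact Finset.card_le_one.1 hle C (by simp [hC, hPC]) C' (by simp [hC', hPC'])

lemma isStrandCover_strands {S : Square I E} (hE' : S.ContainsOuter E') (hD : D ∈ covers I E') :
    S.IsStrandCover (S.strands D) := by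
  have hD' := mem_covers.1 hD
  refine ⟨fun F hF => (S.mem_strands.1 hF).1, fun g hg hge => ?_⟩
  rw [← card_filter_mem_eq_two hD (hE'.mem g hg hge)]
  have hex (C : Finset β) (hC : C ∈ D.filter (g ∈ ·)) : ∃ P ⊆ C, g ∈ P ∧ S.IsStrand P := by
    rw [Finset.mem_filter] at hC
    exact S.exists_isStrand_mem ((Finset.coe_subset.1 (hD'.1 C hC.1).1).trans hE'.subset)
      (hD'.isEven C hC.1) hC.2 hge
  choose strand hsub hmem hstrand using hex
  refine (Finset.card_bij strand ?_ ?_ ?_).symm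
  · intro C hC
    rw [Finset.mem_filter, mem_strands]
    exact ⟨⟨hstrand C hC, C, (Finset.mem_filter.1 hC).1, hsub C hC⟩, hmem C hC⟩
  · intro C hC C' hC' heq
    exact eq_of_isStrand_subset hE' hD (hstrand C hC) (Finset.mem_filter.1 hC).1
      (Finset.mem_filter.1 hC').1 (hsub C hC) (heq ▸ hsub C' hC')
  · intro F hF
    rw [Finset.mem_filter, mem_strands] at hF
    obtain ⟨⟨hF, C, hC, hFC⟩, hgF⟩ := hF
    have hC' : C ∈ D.filter (g ∈ ·) := Finset.mem_filter.2 ⟨hC, hFC hgF⟩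
    refine ⟨C, hC', ((hstrand C hC').eq_or_disjoint hF (hsub C hC') hFC
      fun x _ => hD'.isEven C hC x).resolve_right fun hdisj => ?_⟩
    exact Finset.disjoint_left.1 hdisj (hmem C hC') hgF

end Square

end CycleSpace

end

namespace CycleSpace

/-! ### Patterns of the ends of four paths -/

/-- A schematic edge set made of outer paths and cycle edges: the first component is a set of
indices of outer paths, the second one a set of indices of edges `e i`. -/
abbrev Piece := Finset (Fin 4) × Finset (Fin 4)

/-- The degree of the piece `p` at `v j`, if `n k` is the set of ends of the `k`-th outer path. -/
def pieceDegree (n : Fin 4 → Finset (Fin 4)) (p : Piece) (j : Fin 4) : ℕ :=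
  (p.1.filter (j ∈ n ·)).card + (p.2.filter fun i => j = i ∨ j = i + 1).card

/-- Pieces without mod-2 boundary. -/
def IsEvenPiece (n : Fin 4 → Finset (Fin 4)) (p : Piece) : Prop :=
  ∀ j, Even (pieceDegree n p j)

instance (n : Fin 4 → Finset (Fin 4)) (p : Piece) : Decidable (IsEvenPiece n p) :=
  inferInstanceAs (Decidable (∀ _, _))

/-- Minimal nonempty even pieces. -/
def IsCircuitPiece (n : Fin 4 → Finset (Fin 4)) (p : Piece) : Prop :=
  p ≠ (∅, ∅) ∧ IsEvenPiece n p ∧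
    ∀ S ∈ p.1.powerset, ∀ T ∈ p.2.powerset, IsEvenPiece n (S, T) → (S, T) = (∅, ∅) ∨ (S, T) = p

instance (n : Fin 4 → Finset (Fin 4)) (p : Piece) : Decidable (IsCircuitPiece n p) :=
  inferInstanceAs (Decidable (_ ∧ _))

/-- Schematic double covers: the members are circuit pieces, each outer path is used once and
each edge of the 4-cycle twice. They are lists, so that the kernel can evaluate them. -/
structure IsPieceCover (n : Fin 4 → Finset (Fin 4)) (X : List Piece) : Prop where
  nodup : X.Nodup
  isCircuitPiece : ∀ p ∈ X, IsCircuitPiece n p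
  countP_path : ∀ k, X.countP (k ∈ ·.1) = 1
  countP_edge : ∀ i, X.countP (i ∈ ·.2) = 2

instance (n : Fin 4 → Finset (Fin 4)) (X : List Piece) : Decidable (IsPieceCover n X) :=
  decidable_of_iff (X.Nodup ∧ (∀ p ∈ X, IsCircuitPiece n p) ∧
      (∀ k, X.countP (k ∈ ·.1) = 1) ∧ ∀ i, X.countP (i ∈ ·.2) = 2)
    ⟨fun h => ⟨h.1, h.2.1, h.2.2.1, h.2.2.2⟩, fun h => ⟨h.1, h.2, h.3, h.4⟩⟩

/-- The possible patterns of the ends of the four outer paths, up to the order of the paths. The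
order is chosen such that only paths from `{0, 1}` and `{2, 3}` can be disjoint. -/
def pattern : Fin 6 → Fin 4 → Finset (Fin 4) :=
  ![![{0, 3}, {0, 3}, {1, 2}, {1, 2}], ![{0, 1}, {0, 1}, {2, 3}, {2, 3}],
    ![{0, 2}, {0, 2}, {1, 3}, {1, 3}], ![{0, 1}, {1, 2}, {2, 3}, {0, 3}],
    ![{0, 2}, {2, 3}, {1, 3}, {0, 1}], ![{1, 3}, {0, 3}, {0, 2}, {1, 2}]]

/-- Schematic double covers for each pattern, enough of them for `card_joinings_le`. -/
def patternCovers : Fin 6 → List (List Piece) :=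
  ![[[({0}, {3}), ({1}, {0, 1, 2}), ({2}, {1}), ({3}, {0, 2, 3})],
      [({1}, {3}), ({0}, {0, 1, 2}), ({2}, {1}), ({3}, {0, 2, 3})],
      [({0}, {3}), ({1}, {0, 1, 2}), ({3}, {1}), ({2}, {0, 2, 3})],
      [({1}, {3}), ({0}, {0, 1, 2}), ({3}, {1}), ({2}, {0, 2, 3})],
      [({1}, {3}), ({3}, {1}), ({0, 2}, {0, 2}), (∅, {0, 1, 2, 3})],
      [({1}, {3}), ({2}, {1}), ({0, 3}, {0, 2}), (∅, {0, 1, 2, 3})],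
      [({0}, {3}), ({3}, {1}), ({1, 2}, {0, 2}), (∅, {0, 1, 2, 3})],
      [({0}, {3}), ({2}, {1}), ({1, 3}, {0, 2}), (∅, {0, 1, 2, 3})]],
    [[({0}, {0}), ({1}, {1, 2, 3}), ({2}, {2}), ({3}, {0, 1, 3})],
      [({1}, {0}), ({0}, {1, 2, 3}), ({2}, {2}), ({3}, {0, 1, 3})],
      [({0}, {0}), ({1}, {1, 2, 3}), ({3}, {2}), ({2}, {0, 1, 3})],
      [({1}, {0}), ({0}, {1, 2, 3}), ({3}, {2}), ({2}, {0, 1, 3})],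
      [({1}, {0}), ({3}, {2}), ({0, 2}, {1, 3}), (∅, {0, 1, 2, 3})],
      [({1}, {0}), ({2}, {2}), ({0, 3}, {1, 3}), (∅, {0, 1, 2, 3})],
      [({0}, {0}), ({3}, {2}), ({1, 2}, {1, 3}), (∅, {0, 1, 2, 3})],
      [({0}, {0}), ({2}, {2}), ({1, 3}, {1, 3}), (∅, {0, 1, 2, 3})]],
    [[({0}, {0, 1}), ({1}, {2, 3}), ({2}, {1, 2}), ({3}, {0, 3})],
      [({1}, {0, 1}), ({0}, {2, 3}), ({2}, {1, 2}), ({3}, {0, 3})],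
      [({0}, {0, 1}), ({1}, {2, 3}), ({3}, {1, 2}), ({2}, {0, 3})],
      [({1}, {0, 1}), ({0}, {2, 3}), ({3}, {1, 2}), ({2}, {0, 3})],
      [({0, 2}, {0, 2}), ({1, 3}, {1, 3}), (∅, {0, 1, 2, 3})],
      [({0, 2}, {1, 3}), ({1, 3}, {0, 2}), (∅, {0, 1, 2, 3})],
      [({0, 3}, {0, 2}), ({1, 2}, {1, 3}), (∅, {0, 1, 2, 3})],
      [({0, 3}, {1, 3}), ({1, 2}, {0, 2}), (∅, {0, 1, 2, 3})]],
    [[({0}, {0}), ({1}, {1}), ({2}, {2}), ({3}, {3}), (∅, {0, 1, 2, 3})],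
      [({0, 2}, {1, 3}), ({1, 3}, {0, 2}), (∅, {0, 1, 2, 3})],
      [({3}, {0, 1, 2}), ({1}, {0, 2, 3}), ({0, 2}, {1, 3})],
      [({0}, {1, 2, 3}), ({2}, {0, 1, 3}), ({1, 3}, {0, 2})]],
    [[({0}, {2, 3}), ({1}, {0, 1, 3}), ({2}, {1, 2}), ({3}, {0})],
      [({0}, {0, 1}), ({1}, {2}), ({2}, {0, 3}), ({3}, {1, 2, 3})],
      [({3}, {0}), ({1}, {2}), ({0, 2}, {1, 3}), (∅, {0, 1, 2, 3})],
      [({3}, {1, 2, 3}), ({1}, {0, 1, 3}), ({0, 2}, {0, 2})],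
      [({1, 3}, {1, 3}), ({0, 2}, {0, 2}), (∅, {0, 1, 2, 3})]],
    [[({0}, {0, 3}), ({1}, {0, 1, 2}), ({2}, {2, 3}), ({3}, {1})],
      [({0}, {1, 2}), ({1}, {3}), ({2}, {0, 1}), ({3}, {0, 2, 3})],
      [({3}, {1}), ({1}, {3}), ({0, 2}, {0, 2}), (∅, {0, 1, 2, 3})],
      [({3}, {0, 2, 3}), ({1}, {0, 1, 2}), ({0, 2}, {1, 3})],
      [({1, 3}, {0, 2}), ({0, 2}, {1, 3}), (∅, {0, 1, 2, 3})]]]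

/-- If the edges `e r` and `e (r + 2)` of the 4-cycle are kept and the other two are deleted, then
each outer path with ends `n k` is either closed by a kept edge or joined to the path `π k` by
both kept edges. -/
def IsJoining (r : Fin 4) (n : Fin 4 → Finset (Fin 4)) (π : Fin 4 → Fin 4) : Prop :=
  (∀ k, π (π k) = k) ∧
    ∀ k, if n k = {r, r + 1} ∨ n k = {r + 2, r + 3} then π k = k else n (π k) = (n k)ᶜ

instance (r : Fin 4) (n : Fin 4 → Finset (Fin 4)) (π : Fin 4 → Fin 4) :
    Decidable (IsJoining r n π) :=
  inferInstanceAs (Decidable (_ ∧ _))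

/-- The joinings for each pattern if `e 0` and `e 2` are kept. -/
def joiningsZero : Fin 6 → Finset (Fin 4 → Fin 4) :=
  ![{![2, 3, 0, 1], ![3, 2, 1, 0]}, {![0, 1, 2, 3]}, {![2, 3, 0, 1], ![3, 2, 1, 0]},
    {![0, 3, 2, 1]}, {![2, 1, 0, 3]}, {![2, 3, 0, 1]}]

/-- The joinings for each pattern if `e 1` and `e 3` are kept. -/
def joiningsOne : Fin 6 → Finset (Fin 4 → Fin 4) :=
  ![{![0, 1, 2, 3]}, {![2, 3, 0, 1], ![3, 2, 1, 0]}, {![2, 3, 0, 1], ![3, 2, 1, 0]},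
    {![2, 1, 0, 3]}, {![2, 3, 0, 1]}, {![2, 1, 0, 3]}]

/-- The relation `d` holds for any two paths in the same member of `X`. -/
def PieceAllowed (d : Fin 4 → Fin 4 → Bool) (X : List Piece) : Prop :=
  ∀ p ∈ X, ∀ k ∈ p.1, ∀ l ∈ p.1, k ≠ l → d k l

instance (d : Fin 4 → Fin 4 → Bool) : DecidablePred (PieceAllowed d) :=
  fun _ => inferInstanceAs (Decidable (∀ _ ∈ _, _))

/-- The relation `d` holds for any two paths joined by `π`. -/
def JoiningAllowed (d : Fin 4 → Fin 4 → Bool) (π : Fin 4 → Fin 4) : Prop :=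
  ∀ k, π k ≠ k → d k (π k)

instance (d : Fin 4 → Fin 4 → Bool) : DecidablePred (JoiningAllowed d) :=
  fun _ => inferInstanceAs (Decidable (∀ _, _))

/-- The symmetric relation between `{0, 1}` and `{2, 3}` with the given truth values. -/
def crossTable (a b c d : Bool) : Fin 4 → Fin 4 → Bool :=
  ![![false, false, a, b], ![false, false, c, d], ![a, c, false, false], ![b, d, false, false]]

lemma isPieceCover_of_mem (t : Fin 6) : ∀ X ∈ patternCovers t, IsPieceCover (pattern t) X := by
  revert t; decide +kernel

lemma nodup_map_toFinset_patternCovers (t : Fin 6) :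
    ((patternCovers t).map List.toFinset).Nodup := by
  revert t; decide +kernel

lemma IsJoining.mem_joiningsZero {t : Fin 6} {π : Fin 4 → Fin 4} :
    IsJoining 0 (pattern t) π → π ∈ joiningsZero t := by
  revert t π; decide +kernel

lemma IsJoining.mem_joiningsOne {t : Fin 6} {π : Fin 4 → Fin 4} :
    IsJoining 1 (pattern t) π → π ∈ joiningsOne t := by
  revert t π; decide +kernel

lemma card_joinings_le (t : Fin 6) (a b c d : Bool) :
    2 * ((joiningsZero t).filter (JoiningAllowed (crossTable a b c d))).card +
      2 * ((joiningsOne t).filter (JoiningAllowed (crossTable a b c d))).card ≤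
      ((patternCovers t).filter (PieceAllowed (crossTable a b c d))).length := by
  revert t a b c d; decide +kernel

lemma card_pattern (t : Fin 6) (k : Fin 4) : (pattern t k).card = 2 := by
  revert t k; decide

lemma eq_of_sum_pair_eq_two {N : Finset (Fin 4) → ℕ}
    (hN : ∀ i, ∑ j ∈ Finset.univ.erase i, N {i, j} = 2) :
    N {0, 1} + (N {0, 2} + N {0, 3}) = 2 ∧
      N {2, 3} = N {0, 1} ∧ N {1, 3} = N {0, 2} ∧ N {1, 2} = N {0, 3} := by
  have h0 : N {0, 1} + (N {0, 2} + N {0, 3}) = 2 := by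
    simpa [show Finset.univ.erase (0 : Fin 4) = {1, 2, 3} by decide] using hN 0
  have h1 : N {0, 1} + (N {1, 2} + N {1, 3}) = 2 := by
    rw [Finset.pair_comm 0]
    simpa [show Finset.univ.erase (1 : Fin 4) = {0, 2, 3} by decide] using hN 1
  have h2 : N {0, 2} + (N {1, 2} + N {2, 3}) = 2 := by
    rw [Finset.pair_comm 0, Finset.pair_comm 1]
    simpa [show Finset.univ.erase (2 : Fin 4) = {0, 1, 3} by decide] using hN 2
  have h3 : N {0, 3} + (N {1, 3} + N {2, 3}) = 2 := by
    rw [Finset.pair_comm 0, Finset.pair_comm 1, Finset.pair_comm 2]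
    simpa [show Finset.univ.erase (3 : Fin 4) = {0, 1, 2} by decide] using hN 3
  omega

lemma exists_card_pattern_eq (N : Finset (Fin 4) → ℕ)
    (hN : ∀ i, ∑ j ∈ Finset.univ.erase i, N {i, j} = 2) :
    ∃ t, ∀ i j, i ≠ j → (Finset.univ.filter (pattern t · = {i, j})).card = N {i, j} := by
  obtain ⟨hsum, hcompl⟩ := eq_of_sum_pair_eq_two hN
  have hlt (t : Fin 6) (h : ∀ i j, i < j → (Finset.univ.filter (pattern t · = {i, j})).card =
      ![![0, N {0, 1}, N {0, 2}, N {0, 3}], ![0, 0, N {0, 3}, N {0, 2}], ![0, 0, 0, N {0, 1}],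
        ![0, 0, 0, 0]] i j) :
      ∃ t, ∀ i j, i ≠ j → (Finset.univ.filter (pattern t · = {i, j})).card = N {i, j} := by
    have hup (i j : Fin 4) (hij : i < j) :
        (Finset.univ.filter (pattern t · = {i, j})).card = N {i, j} := by
      rw [h i j hij]
      fin_cases i <;> fin_cases j <;> first | exact absurd hij (by decide) | simp [hcompl]
    refine ⟨t, fun i j hij => hij.lt_or_gt.elim (hup i j) fun h => ?_⟩
    rw [Finset.pair_comm, hup j i h]
  generalize N {0, 1} = a, N {0, 2} = b, N {0, 3} = c at hsum hlt
  obtain ⟨rfl, rfl, rfl⟩ | ⟨rfl, rfl, rfl⟩ | ⟨rfl, rfl, rfl⟩ | ⟨rfl, rfl, rfl⟩ | ⟨rfl, rfl, rfl⟩ |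
      ⟨rfl, rfl, rfl⟩ : (a = 0 ∧ b = 0 ∧ c = 2) ∨ (a = 2 ∧ b = 0 ∧ c = 0) ∨
      (a = 0 ∧ b = 2 ∧ c = 0) ∨ (a = 1 ∧ b = 0 ∧ c = 1) ∨ (a = 1 ∧ b = 1 ∧ c = 0) ∨
      (a = 0 ∧ b = 1 ∧ c = 1) := by omega
  exacts [hlt 0 (by decide), hlt 1 (by decide), hlt 2 (by decide), hlt 3 (by decide),
    hlt 4 (by decide), hlt 5 (by decide)]

end CycleSpace

section

open scoped Classical

namespace CycleSpace

/-! ### Double covers from strands -/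

namespace Square

variable {α β : Type*} {I : β → α → Prop} {E : Finset β} {S : Square I E}
  {O : Finset (Finset β)} {F : Finset β} {p q : Piece} {g : β} {x : α} {i k : Fin 4}

/-- The members of a strand cover `O` with ends on the 4-cycle, numbered by `Fin 4`: they are
paths, and there are four of them because each `f i` lies in two of them. -/
structure PathLabelling (S : Square I E) (O : Finset (Finset β)) where
  isStrandCover : S.IsStrandCover O
  path : Fin 4 → Finset β
  path_injective : Function.Injective path
  mem_range_path : ∀ F, F ∈ Set.range path ↔ F ∈ O ∧ (S.endsOf F).Nonempty

lemma IsStrandCover.sum_card_endsOf_eq (hO : S.IsStrandCover O) (i : Fin 4) :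
    ∑ j ∈ Finset.univ.erase i, (O.filter (S.endsOf · = {i, j})).card = 2 := by
  rw [← hO.card_eq_two _ (S.f_mem i) (S.f_notMem_range_e i), ← Finset.card_biUnion]
  · congr 1
    ext F
    simp only [Finset.mem_biUnion, Finset.mem_erase, Finset.mem_univ, and_true, Finset.mem_filter]
    constructor
    · rintro ⟨j, -, hF, hends⟩
      exact ⟨hF, S.mem_endsOf.1 (by simp [hends])⟩
    · rintro ⟨hF, hi⟩
      obtain ⟨j, hj, hends⟩ := (hO.isStrand F hF).exists_endsOf_eq (S.mem_endsOf.2 hi)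
      exact ⟨j, hj, hF, hends⟩
  · intro j hj k _ hjk
    refine Finset.disjoint_filter.2 fun F _ hF hF' => hjk ?_
    have hjk' : j ∈ ({i, k} : Finset (Fin 4)) := by simp [← hF', hF]
    exact (Finset.mem_insert.1 hjk').elim (absurd · (Finset.ne_of_mem_erase hj)) (by simp)

namespace PathLabelling

/-- The indices of the ends of the `k`-th path. -/
noncomputable def ends (L : S.PathLabelling O) (k : Fin 4) : Finset (Fin 4) :=
  S.endsOf (L.path k)

end PathLabelling

lemma IsStrandCover.card_filter_pattern_eq {t : Fin 6} (hO : S.IsStrandCover O)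
    (ht : ∀ i j, i ≠ j → (Finset.univ.filter (pattern t · = {i, j})).card =
      (O.filter (S.endsOf · = {i, j})).card) (s : Finset (Fin 4)) :
    (Finset.univ.filter (pattern t · = s)).card =
      ((O.filter fun F => (S.endsOf F).Nonempty).filter (S.endsOf · = s)).card := by
  rw [Finset.filter_filter]
  by_cases hs : s.card = 2
  · obtain ⟨i, j, hij, rfl⟩ := Finset.card_eq_two.1 hs
    rw [ht i j hij]
    congr 1
    exact Finset.filter_congr fun F _ => (and_iff_right_of_imp fun h => by simp [h]).symm
  · rw [Finset.filter_false_of_mem, Finset.filter_false_of_mem, Finset.card_empty,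
      Finset.card_empty]
    · rintro F hF ⟨⟨i, hi⟩, rfl⟩
      obtain ⟨j, hj, hends⟩ := (hO.isStrand F hF).exists_endsOf_eq hi
      exact hs (hends ▸ Finset.card_pair hj.symm)
    · rintro k - rfl
      exact hs (card_pattern t k)

lemma IsStrandCover.exists_pathLabelling (hO : S.IsStrandCover O) :
    ∃ t, ∃ L : S.PathLabelling O, L.ends = pattern t := by
  obtain ⟨t, ht⟩ := exists_card_pattern_eq (fun s => (O.filter (S.endsOf · = s)).card)
    hO.sum_card_endsOf_eq
  set O' := O.filter fun F => (S.endsOf F).Nonempty with hO'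
  have hcard (s : Finset (Fin 4)) : Fintype.card {k // pattern t k = s} =
      Fintype.card {F : O' // S.endsOf F = s} := by
    rw [Fintype.card_subtype, hO.card_filter_pattern_eq ht, Fintype.card_subtype,
      Finset.univ_eq_attach, Finset.filter_attach (S.endsOf · = s), Finset.card_map,
      Finset.card_attach]
  let φ : Fin 4 ≃ O' := Equiv.ofFiberEquiv fun s => Fintype.equivOfCardEq (hcard s)
  refine ⟨t, ⟨hO, fun k => φ k, Subtype.val_injective.comp φ.injective, fun F => ?_⟩, ?_⟩
  · rw [← Finset.mem_filter (s := O) (p := fun F => (S.endsOf F).Nonempty), ← hO']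
    exact ⟨by rintro ⟨k, rfl⟩; exact (φ k).2, fun hF => ⟨φ.symm ⟨F, hF⟩, by simp⟩⟩
  · funext k
    exact Equiv.ofFiberEquiv_map (g := fun F : O' => S.endsOf F) _ k

namespace PathLabelling

lemma path_mem (L : S.PathLabelling O) (k : Fin 4) : L.path k ∈ O :=
  ((L.mem_range_path _).1 ⟨k, rfl⟩).1

lemma ends_nonempty (L : S.PathLabelling O) (k : Fin 4) : (L.ends k).Nonempty :=
  ((L.mem_range_path _).1 ⟨k, rfl⟩).2

lemma mem_ends (L : S.PathLabelling O) : i ∈ L.ends k ↔ S.f i ∈ L.path k :=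
  S.mem_endsOf

lemma isStrand (L : S.PathLabelling O) (k : Fin 4) : S.IsStrand (L.path k) :=
  L.isStrandCover.isStrand _ (L.path_mem k)

lemma isOuterEven (L : S.PathLabelling O) (k : Fin 4) : S.IsOuterEven (L.path k) :=
  (L.isStrand k).prop.2

lemma exists_path_eq (L : S.PathLabelling O) (hF : F ∈ O) (hends : (S.endsOf F).Nonempty) :
    ∃ k, L.path k = F :=
  (L.mem_range_path F).2 ⟨hF, hends⟩

/-- The edge set described by a piece. -/
noncomputable def glue (L : S.PathLabelling O) (p : Piece) : Finset β :=
  p.1.biUnion L.path ∪ p.2.image S.e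

/-- The paths of the piece `p` are pairwise disjoint, so that its degrees are those of the edge
set it describes. -/
def PieceDisjoint (L : S.PathLabelling O) (p : Piece) : Prop :=
  (p.1 : Set (Fin 4)).PairwiseDisjoint L.path

lemma mem_glue (L : S.PathLabelling O) :
    g ∈ L.glue p ↔ (∃ k ∈ p.1, g ∈ L.path k) ∨ ∃ i ∈ p.2, S.e i = g := by
  simp [glue]

lemma path_subset_glue (L : S.PathLabelling O) (hk : k ∈ p.1) : L.path k ⊆ L.glue p :=
  fun _ hg => L.mem_glue.2 (Or.inl ⟨k, hk, hg⟩)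

lemma glue_subset (L : S.PathLabelling O) {C : Finset β} (hpath : ∀ k ∈ p.1, L.path k ⊆ C)
    (hedge : ∀ i ∈ p.2, S.e i ∈ C) : L.glue p ⊆ C :=
  Finset.union_subset (Finset.biUnion_subset.2 hpath) (Finset.image_subset_iff.2 hedge)

lemma e_mem_glue (L : S.PathLabelling O) : S.e i ∈ L.glue p ↔ i ∈ p.2 := by
  simp [mem_glue, (L.isOuterEven _).e_notMem, S.e_injective.eq_iff]

lemma glue_nonempty (L : S.PathLabelling O) (hp : p ≠ (∅, ∅)) : (L.glue p).Nonempty := by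
  rw [Finset.nonempty_iff_ne_empty]
  intro h
  refine hp (Prod.ext (Finset.eq_empty_of_forall_notMem fun k hk => ?_)
    (Finset.eq_empty_of_forall_notMem fun i hi => ?_))
  · exact (L.isStrand k).prop.1.ne_empty (Finset.subset_empty.1 (h ▸ L.path_subset_glue hk))
  · simpa [h] using L.e_mem_glue.2 hi

lemma boundary_glue (L : S.PathLabelling O) (hp : L.PieceDisjoint p) (x : α) :
    boundary I (L.glue p) x =
      (∑ k ∈ p.1, boundary I (L.path k) x) + ∑ i ∈ p.2, if I (S.e i) x then 1 else 0 := by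
  have hdisj : Disjoint (p.1.biUnion L.path) (p.2.image S.e) := by
    simp [Finset.disjoint_right, (L.isOuterEven _).e_notMem]
  rw [glue, boundary_union hdisj, boundary, boundary, Finset.sum_biUnion hp,
    Finset.sum_image S.e_injective.injOn]
  rfl

lemma boundary_glue_outer (L : S.PathLabelling O) (hp : L.PieceDisjoint p)
    (hx : x ∉ Set.range S.v) : boundary I (L.glue p) x = 0 := by
  rw [L.boundary_glue hp, Finset.sum_eq_zero, Finset.sum_eq_zero, add_zero]
  · exact fun i _ => if_neg fun hi => S.notMem_range_e_of_inc hx hi ⟨i, rfl⟩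
  · exact fun k _ => (L.isOuterEven k).boundary_eq_zero x hx

lemma boundary_glue_v (L : S.PathLabelling O) (hp : L.PieceDisjoint p) (j : Fin 4) :
    boundary I (L.glue p) (S.v j) = pieceDegree L.ends p j := by
  rw [L.boundary_glue hp, pieceDegree, Nat.cast_add, Finset.natCast_card_filter,
    Finset.natCast_card_filter]
  simp only [(L.isOuterEven _).boundary_v, S.inc_e_iff, S.v_injective.eq_iff, ends]
  congr!

lemma isEven_glue (L : S.PathLabelling O) (hp : L.PieceDisjoint p) :
    IsEven I (L.glue p) ↔ IsEvenPiece L.ends p := by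
  simp only [IsEven, IsEvenPiece, ← ZMod.natCast_eq_zero_iff_even, ← L.boundary_glue_v hp]
  refine ⟨fun h j => h _, fun h x => ?_⟩
  by_cases hx : x ∈ Set.range S.v
  · obtain ⟨j, rfl⟩ := hx
    exact h j
  · exact L.boundary_glue_outer hp hx

lemma exists_path_eq_of_subset_glue (L : S.PathLabelling O) (hp : L.PieceDisjoint p)
    (hF : S.IsStrand F) (hsub : F ⊆ L.glue p) : ∃ k ∈ p.1, L.path k = F := by
  obtain ⟨g, hg⟩ := hF.prop.1
  rcases L.mem_glue.1 (hsub hg) with ⟨k, hk, hgk⟩ | ⟨i, -, rfl⟩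
  · refine ⟨k, hk, ((L.isStrand k).eq_or_disjoint hF (L.path_subset_glue hk) hsub
      fun x hx => L.boundary_glue_outer hp hx).resolve_right fun hdisj => ?_⟩
    exact Finset.disjoint_left.1 hdisj hgk hg
  · exact absurd hg (hF.prop.2.e_notMem i)

lemma path_subset_glue_iff (L : S.PathLabelling O) (hp : L.PieceDisjoint p) :
    L.path k ⊆ L.glue p ↔ k ∈ p.1 := by
  refine ⟨fun hk => ?_, L.path_subset_glue⟩
  obtain ⟨l, hl, hlk⟩ := L.exists_path_eq_of_subset_glue hp (L.isStrand k) hk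
  exact L.path_injective hlk ▸ hl

lemma glue_inj (L : S.PathLabelling O) (hp : L.PieceDisjoint p) (hq : L.PieceDisjoint q)
    (h : L.glue p = L.glue q) : p = q := by
  refine Prod.ext (Finset.ext fun k => ?_) (Finset.ext fun i => ?_)
  · rw [← L.path_subset_glue_iff hp, h, L.path_subset_glue_iff hq]
  · rw [← L.e_mem_glue, h, L.e_mem_glue]

lemma exists_glue_eq_of_subset_glue (L : S.PathLabelling O) (hp : L.PieceDisjoint p)
    (hF : IsEven I F) (hsub : F ⊆ L.glue p) :
    ∃ q : Piece, q.1 ⊆ p.1 ∧ q.2 ⊆ p.2 ∧ L.glue q = F := by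
  have hcase (k) (hk : k ∈ p.1) : L.path k ⊆ F ∨ Disjoint (L.path k) F :=
    (L.isStrand k).subset_or_disjoint (L.path_subset_glue hk) hsub
      (fun x hx => L.boundary_glue_outer hp hx) fun x _ => hF x
  refine ⟨(p.1.filter (L.path · ⊆ F), p.2.filter (S.e · ∈ F)), Finset.filter_subset _ _,
    Finset.filter_subset _ _, ?_⟩
  refine (L.glue_subset (by simp) (by simp)).antisymm fun g hg => ?_
  rcases L.mem_glue.1 (hsub hg) with ⟨k, hk, hgk⟩ | ⟨i, hi, rfl⟩
  · have hkF := (hcase k hk).resolve_right fun hdisj => Finset.disjoint_left.1 hdisj hgk hg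
    exact L.mem_glue.2 (Or.inl ⟨k, Finset.mem_filter.2 ⟨hk, hkF⟩, hgk⟩)
  · exact L.e_mem_glue.2 (Finset.mem_filter.2 ⟨hi, hg⟩)

lemma isCircuitSet_glue (L : S.PathLabelling O) (hp : L.PieceDisjoint p)
    (hcirc : IsCircuitPiece L.ends p) : IsCircuitSet I (L.glue p) := by
  obtain ⟨hne, heven, hmin⟩ := hcirc
  refine ⟨⟨L.glue_nonempty hne, (L.isEven_glue hp).2 heven⟩, fun F hF hsub => ?_⟩
  obtain ⟨q, hq₁, hq₂, rfl⟩ := L.exists_glue_eq_of_subset_glue hp hF.2 hsub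
  have hq : L.PieceDisjoint q := hp.subset (Finset.coe_subset.2 hq₁)
  rcases hmin q.1 (Finset.mem_powerset.2 hq₁) q.2 (Finset.mem_powerset.2 hq₂)
    ((L.isEven_glue hq).1 hF.2) with h | h
  · exact absurd hF.1 (by simp [show q = (∅, ∅) from h, glue])
  · rw [show q = p from h]

/-- The family of edge sets described by a set of pieces, together with the circuits of `O`. -/
noncomputable def glueAll (L : S.PathLabelling O) (X : Finset Piece) : Finset (Finset β) :=
  O.filter (S.endsOf · = ∅) ∪ X.image L.glue

lemma mem_glueAll (L : S.PathLabelling O) {X : Finset Piece} :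
    F ∈ L.glueAll X ↔ F ∈ O ∧ S.endsOf F = ∅ ∨ ∃ p ∈ X, L.glue p = F := by
  simp [glueAll]

lemma glue_notMem (L : S.PathLabelling O) (hp : p ≠ (∅, ∅)) :
    ¬ (L.glue p ∈ O ∧ S.endsOf (L.glue p) = ∅) := by
  rintro ⟨hmem, hends⟩
  refine hp (Prod.ext (Finset.eq_empty_of_forall_notMem fun k hk => ?_)
    (Finset.eq_empty_of_forall_notMem fun i hi => ?_))
  · obtain ⟨i, hi⟩ := L.ends_nonempty k
    have : i ∈ S.endsOf (L.glue p) := S.mem_endsOf.2 (L.path_subset_glue hk (L.mem_ends.1 hi))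
    simp [hends] at this
  · exact (L.isStrandCover.isStrand _ hmem).prop.2.e_notMem i (L.e_mem_glue.2 hi)

lemma glueAll_inj (L : S.PathLabelling O) {X Y : Finset Piece}
    (hX : ∀ p ∈ X, p ≠ (∅, ∅) ∧ L.PieceDisjoint p) (hY : ∀ p ∈ Y, p ≠ (∅, ∅) ∧ L.PieceDisjoint p)
    (h : L.glueAll X = L.glueAll Y) : X = Y := by
  have subset_of {X Y : Finset Piece} (hX : ∀ p ∈ X, p ≠ (∅, ∅) ∧ L.PieceDisjoint p)
      (hY : ∀ p ∈ Y, p ≠ (∅, ∅) ∧ L.PieceDisjoint p) (h : L.glueAll X = L.glueAll Y) : X ⊆ Y := by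
    intro p hp
    have hmem : L.glue p ∈ L.glueAll Y := h ▸ L.mem_glueAll.2 (Or.inr ⟨p, hp, rfl⟩)
    obtain ⟨q, hq, hqp⟩ := (L.mem_glueAll.1 hmem).resolve_left (L.glue_notMem (hX p hp).1)
    rwa [← L.glue_inj (hY q hq).2 (hX p hp).2 hqp]
  exact (subset_of hX hY h).antisymm (subset_of hY hX h.symm)

lemma strands_glueAll (L : S.PathLabelling O) {X : List Piece} (hX : IsPieceCover L.ends X)
    (hdisj : ∀ p ∈ X, L.PieceDisjoint p) : S.strands (L.glueAll X.toFinset) = O := by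
  ext F
  simp only [mem_strands, mem_glueAll, List.mem_toFinset]
  constructor
  · rintro ⟨hF, C, ⟨hC, -⟩ | ⟨p, hp, rfl⟩, hFC⟩
    · rwa [(L.isStrandCover.isStrand C hC).eq_of_subset hF.prop.1 hF.prop.2 hFC]
    · obtain ⟨k, -, rfl⟩ := L.exists_path_eq_of_subset_glue (hdisj p hp) hF hFC
      exact L.path_mem k
  · intro hF
    refine ⟨L.isStrandCover.isStrand F hF, ?_⟩
    rcases (S.endsOf F).eq_empty_or_nonempty with hends | hends
    · exact ⟨F, Or.inl ⟨hF, hends⟩, subset_rfl⟩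
    · obtain ⟨k, rfl⟩ := L.exists_path_eq hF hends
      obtain ⟨p, hp, hk⟩ := List.countP_pos_iff.1 ((hX.countP_path k).symm ▸ Nat.one_pos)
      exact ⟨L.glue p, Or.inr ⟨p, hp, rfl⟩, L.path_subset_glue (by simpa using hk)⟩

lemma card_filter_mem_glueAll (L : S.PathLabelling O) {X : List Piece} (hnd : X.Nodup)
    (hX : ∀ p ∈ X, p ≠ (∅, ∅) ∧ L.PieceDisjoint p) (g : β) :
    ((L.glueAll X.toFinset).filter (g ∈ ·)).card =
      (O.filter fun F => S.endsOf F = ∅ ∧ g ∈ F).card + X.countP (g ∈ L.glue ·) := by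
  have hinj : Set.InjOn L.glue (X.toFinset.filter (g ∈ L.glue ·)) := fun p hp q hq =>
    L.glue_inj (hX p (by simp_all)).2 (hX q (by simp_all)).2
  have hdisj : Disjoint (O.filter (S.endsOf · = ∅)) (X.toFinset.image L.glue) := by
    simp only [Finset.disjoint_right, Finset.mem_image, List.mem_toFinset, Finset.mem_filter]
    rintro _ ⟨p, hp, rfl⟩
    exact L.glue_notMem (hX p hp).1
  rw [glueAll, Finset.filter_union, Finset.card_union_of_disjoint
    (Finset.disjoint_filter_filter hdisj), Finset.filter_filter, Finset.filter_image,
    Finset.card_image_of_injOn hinj, List.countP_eq_length_filter,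
    ← List.toFinset_card_of_nodup (hnd.filter _), List.toFinset_filter]
  simp

lemma countP_mem_glue (L : S.PathLabelling O) (hg : g ∉ Set.range S.e) {X : List Piece}
    (hX : ∀ p ∈ X, L.PieceDisjoint p) :
    X.countP (g ∈ L.glue ·) = ∑ k with g ∈ L.path k, X.countP (k ∈ ·.1) := by
  induction X with
  | nil => simp
  | cons p X ih =>
    have hp : (if g ∈ L.glue p then 1 else 0) = (p.1.filter (g ∈ L.path ·)).card := by
      by_cases hgp : g ∈ L.glue p
      · obtain ⟨k, hk, hgk⟩ := (L.mem_glue.1 hgp).resolve_right fun ⟨i, _, hi⟩ => hg ⟨i, hi⟩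
        rw [if_pos hgp, eq_comm, Finset.card_eq_one]
        refine ⟨k, Finset.ext fun l => ?_⟩
        simp only [Finset.mem_filter, Finset.mem_singleton]
        refine ⟨fun hl => ?_, by rintro rfl; exact ⟨hk, hgk⟩⟩
        exact (hX p List.mem_cons_self).elim hl.1 hk
          (Finset.not_disjoint_iff.2 ⟨g, hl.2, hgk⟩)
      · rw [if_neg hgp, eq_comm, Finset.card_eq_zero, Finset.filter_eq_empty_iff]
        exact fun k hk hgk => hgp (L.path_subset_glue hk hgk)
    simp only [List.countP_cons, decide_eq_true_eq, Finset.sum_add_distrib,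
      ih fun q hq => hX q (List.mem_cons_of_mem p hq), hp, ← Finset.card_filter]
    congr 2
    ext k
    simp [and_comm]

lemma card_filter_path (L : S.PathLabelling O) (g : β) :
    (O.filter fun F => S.endsOf F = ∅ ∧ g ∈ F).card + (Finset.univ.filter (g ∈ L.path ·)).card =
      (O.filter (g ∈ ·)).card := by
  have himage : (O.filter fun F => g ∈ F ∧ ¬ S.endsOf F = ∅) =
      (Finset.univ.filter (g ∈ L.path ·)).image L.path := by
    ext F
    simp only [Finset.mem_filter, Finset.mem_image, Finset.mem_univ, true_and]
    constructor
    · rintro ⟨hF, hgF, hne⟩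
      obtain ⟨k, rfl⟩ := L.exists_path_eq hF (Finset.nonempty_iff_ne_empty.2 hne)
      exact ⟨k, hgF, rfl⟩
    · rintro ⟨k, hgk, rfl⟩
      exact ⟨L.path_mem k, hgk, (L.ends_nonempty k).ne_empty⟩
  rw [← Finset.card_filter_add_card_filter_not (s := O.filter (g ∈ ·)) (S.endsOf · = ∅),
    Finset.filter_filter, Finset.filter_filter, himage,
    Finset.card_image_of_injective _ L.path_injective]
  simp only [and_comm]

lemma glueAll_mem_covers (L : S.PathLabelling O) {X : List Piece} (hX : IsPieceCover L.ends X)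
    (hdisj : ∀ p ∈ X, L.PieceDisjoint p) : L.glueAll X.toFinset ∈ covers I E := by
  refine mem_covers.2 ⟨fun F hF => ?_, fun g hg => ?_⟩
  · rcases L.mem_glueAll.1 hF with ⟨hF, hends⟩ | ⟨p, hp, rfl⟩
    · have hstrand := L.isStrandCover.isStrand F hF
      exact ⟨Finset.coe_subset.2 hstrand.prop.2.subset, hstrand.isCircuitSet hends⟩
    · rw [List.mem_toFinset] at hp
      refine ⟨Finset.coe_subset.2 (L.glue_subset (fun k _ => (L.isOuterEven k).subset)
        fun i _ => S.e_mem i), L.isCircuitSet_glue (hdisj p hp) (hX.isCircuitPiece p hp)⟩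
  · rw [Multiset.countP_eq_card_filter]
    change ((L.glueAll X.toFinset).filter (g ∈ ·)).card = 2
    rw [L.card_filter_mem_glueAll hX.nodup fun p hp => ⟨(hX.isCircuitPiece p hp).1, hdisj p hp⟩]
    by_cases hge : g ∈ Set.range S.e
    · obtain ⟨i, rfl⟩ := hge
      simp only [L.e_mem_glue]
      rw [hX.countP_edge, Finset.filter_false_of_mem, Finset.card_empty]
      exact fun F hF h => (L.isStrandCover.isStrand F hF).prop.2.e_notMem i h.2
    · rw [L.countP_mem_glue hge hdisj, Finset.sum_congr rfl fun k _ => hX.countP_path k,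
        ← Finset.card_eq_sum_ones, L.card_filter_path, L.isStrandCover.card_eq_two g hg hge]

end PathLabelling

end Square

/-- The index of the edge at `v j` among the edges `e r` and `e (r + 2)`. -/
def keptAt (r j : Fin 4) : Fin 4 :=
  if j = r ∨ j = r + 1 then r else r + 2

lemma isEvenPiece_singleton {r k : Fin 4} {n : Fin 4 → Finset (Fin 4)}
    (h : n k = {r, r + 1} ∨ n k = {r + 2, r + 3}) :
    IsEvenPiece n ({k}, (n k).image (keptAt r)) := by
  intro j
  have hdeg : ∀ (r : Fin 4) (m : Finset (Fin 4)), m = {r, r + 1} ∨ m = {r + 2, r + 3} → ∀ j,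
      Even ((if j ∈ m then 1 else 0) +
        ((m.image (keptAt r)).filter fun i => j = i ∨ j = i + 1).card) := by decide +kernel
  convert hdeg r (n k) h j
  simp only [pieceDegree, Finset.card_filter, Finset.sum_singleton]

lemma isEvenPiece_pair {r k l : Fin 4} {n : Fin 4 → Finset (Fin 4)} (hcard : (n k).card = 2)
    (h : ¬ (n k = {r, r + 1} ∨ n k = {r + 2, r + 3})) (hl : n l = (n k)ᶜ) :
    IsEvenPiece n ({k, l}, (n k).image (keptAt r)) := by
  intro j
  have hne : k ≠ l := by
    rintro rfl
    exact ne_compl_self hl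
  have hkept : ∀ (r : Fin 4) (m : Finset (Fin 4)), m.card = 2 →
      ¬ (m = {r, r + 1} ∨ m = {r + 2, r + 3}) → ∀ j,
        ((m.image (keptAt r)).filter fun i => j = i ∨ j = i + 1).card = 1 := by decide +kernel
  have hpath : (({k, l} : Finset (Fin 4)).filter (j ∈ n ·)).card = 1 := by
    rw [Finset.card_filter, Finset.sum_pair hne, hl]
    by_cases hj : j ∈ n k <;> simp [hj]
  rw [pieceDegree, hkept r (n k) hcard h, hpath]
  exact even_two

namespace Square

variable {α β : Type*} {I : β → α → Prop} {E : Finset β} {S : Square I E} {C : Finset β}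
  {D O : Finset (Finset β)} {r k l : Fin 4}

/-- The edge set obtained by deleting `e (r + 1)` and `e (r + 3)`. -/
noncomputable def keeping (S : Square I E) (r : Fin 4) : Finset β :=
  E \ {S.e (r + 1), S.e (r + 3)}

lemma containsOuter_keeping (S : Square I E) (r : Fin 4) : S.ContainsOuter (S.keeping r) where
  subset := Finset.sdiff_subset
  mem g hg hge := by
    simp only [keeping, Finset.mem_sdiff, hg, true_and, Finset.mem_insert, Finset.mem_singleton]
    rintro (rfl | rfl) <;> exact hge ⟨_, rfl⟩

lemma f_mem_iff (S : Square I E) (hC : IsEven I C) (hCE : C ⊆ S.keeping r) (j : Fin 4) :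
    S.f j ∈ C ↔ S.e (keptAt r j) ∈ C := by
  have h₁ : S.e (r + 1) ∉ C := fun h => by simpa [keeping] using hCE h
  have h₃ : S.e (r + 3) ∉ C := fun h => by simpa [keeping] using hCE h
  have hkept : ∀ r j : Fin 4, keptAt r j = j ∧ (j - 1 = r + 1 ∨ j - 1 = r + 3) ∨
      keptAt r j = j - 1 ∧ (j = r + 1 ∨ j = r + 3) := by decide
  have hclaw := (S.claw_v j).boundary_eq_zero_iff.1 (hC (S.v j))
  rcases hkept r j with ⟨hj, hdel⟩ | ⟨hj, hdel⟩
  · have hpred : S.e (j - 1) ∉ C := by rcases hdel with h | h <;> rwa [h]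
    rw [hj]
    tauto
  · have hj' : S.e j ∉ C := by rcases hdel with h | h <;> rwa [h]
    rw [hj, hclaw.2 hj']

lemma exists_mem_notMem_range_e (S : Square I E) (hC : IsEven I C) (hne : C.Nonempty)
    (hCE : C ⊆ S.keeping r) : ∃ g ∈ C, g ∉ Set.range S.e := by
  by_contra! hall
  obtain ⟨g, hg⟩ := hne
  obtain ⟨i, rfl⟩ := hall g hg
  have hkept : ∀ r i : Fin 4, i = r + 1 ∨ i = r + 3 ∨ keptAt r i = i := by decide
  rcases hkept r i with rfl | rfl | hi
  · simpa [keeping] using hCE hg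
  · simpa [keeping] using hCE hg
  · exact S.f_notMem_range_e i (hall _ ((S.f_mem_iff hC hCE i).2 (hi.symm ▸ hg)))

namespace PathLabelling

lemma card_ends (L : S.PathLabelling O) (k : Fin 4) : (L.ends k).card = 2 := by
  obtain ⟨i, hi⟩ := L.ends_nonempty k
  obtain ⟨j, hj, hends⟩ := (L.isStrand k).exists_endsOf_eq hi
  rw [ends, hends, Finset.card_pair hj.symm]

lemma pieceDisjoint_pair (L : S.PathLabelling O) {T : Finset (Fin 4)}
    (h : k ≠ l → Disjoint (L.path k) (L.path l)) : L.PieceDisjoint ({k, l}, T) := by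
  simp only [PieceDisjoint, Set.PairwiseDisjoint, Finset.coe_pair]
  exact (Set.pairwise_pair (r := Function.onFun Disjoint L.path)).2 fun hkl => ⟨h hkl, (h hkl).symm⟩

lemma ends_eq_compl_of_disjoint (L : S.PathLabelling O) (h : Disjoint (L.path k) (L.path l)) :
    L.ends l = (L.ends k)ᶜ := by
  refine Finset.eq_of_subset_of_card_le (fun i hi => ?_) ?_
  · rw [Finset.mem_compl]
    exact fun hi' => Finset.disjoint_left.1 h (L.mem_ends.1 hi') (L.mem_ends.1 hi)
  · simp [Finset.card_compl, L.card_ends]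

/-- The piece through the `k`-th and the `l`-th path that has the edges `e r` and `e (r + 2)` only
and meets the 4-cycle in the ends of the `k`-th path. -/
noncomputable def joinPiece (L : S.PathLabelling O) (r k l : Fin 4) : Piece :=
  ({k, l}, (L.ends k).image (keptAt r))

lemma path_subset_glue_joinPiece (L : S.PathLabelling O) (r k l : Fin 4) :
    L.path k ⊆ L.glue (L.joinPiece r k l) :=
  L.path_subset_glue (by simp [joinPiece])

lemma glue_joinPiece_eq (L : S.PathLabelling O) (hC : IsCircuitSet I C) (hCE : C ⊆ S.keeping r)
    (hk : L.path k ⊆ C) (hl : L.path l ⊆ C) (hdisj : k ≠ l → Disjoint (L.path k) (L.path l))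
    (heven : IsEvenPiece L.ends (L.joinPiece r k l)) : L.glue (L.joinPiece r k l) = C := by
  refine hC.eq_of_le ⟨L.glue_nonempty fun h => ?_, (L.isEven_glue (L.pieceDisjoint_pair hdisj)).2
    heven⟩ (L.glue_subset (by simp [joinPiece, hk, hl]) fun i hi => ?_)
  · simpa [joinPiece] using congrArg Prod.fst h
  · obtain ⟨j, hj, rfl⟩ := Finset.mem_image.1 hi
    exact (S.f_mem_iff hC.prop.2 hCE j).1 (hk (L.mem_ends.1 hj))

section Joining

variable (L : S.PathLabelling (S.strands D))

lemma exists_disjoint_path (hD : D ∈ covers I (S.keeping r)) (hC : C ∈ D) (hk : L.path k ⊆ C)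
    (h : ¬ (L.ends k = {r, r + 1} ∨ L.ends k = {r + 2, r + 3})) :
    ∃ l, L.path l ⊆ C ∧ Disjoint (L.path k) (L.path l) := by
  obtain ⟨hCE, hcirc⟩ := (mem_covers.1 hD).1 C hC
  rw [Finset.coe_subset] at hCE
  have hkept : ∀ (r : Fin 4) (m : Finset (Fin 4)), m.card = 2 →
      ¬ (m = {r, r + 1} ∨ m = {r + 2, r + 3}) →
        ∃ i ∉ m, ∃ j ∈ m, keptAt r i = keptAt r j := by decide +kernel
  obtain ⟨i, hik, j, hjk, hij⟩ := hkept r _ (L.card_ends k) h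
  have hi : S.f i ∈ C := by
    rw [S.f_mem_iff hcirc.prop.2 hCE, hij, ← S.f_mem_iff hcirc.prop.2 hCE]
    exact hk (L.mem_ends.1 hjk)
  obtain ⟨P, hPC, hiP, hP⟩ := S.exists_isStrand_mem
    (hCE.trans (S.containsOuter_keeping r).subset) hcirc.prop.2 hi (S.f_notMem_range_e i)
  obtain ⟨l, rfl⟩ := L.exists_path_eq (S.mem_strands.2 ⟨hP, C, hC, hPC⟩)
    ⟨i, S.mem_endsOf.2 hiP⟩
  refine ⟨l, hPC, ((L.isStrand k).eq_or_disjoint hP hk hPC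
    fun x _ => hcirc.prop.2 x).resolve_left fun heq => ?_⟩
  exact hik (L.mem_ends.2 (heq ▸ hiP))

lemma exists_partner (hD : D ∈ covers I (S.keeping r)) (k : Fin 4) :
    ∃ l, L.glue (L.joinPiece r k l) ∈ D ∧ (k ≠ l → Disjoint (L.path k) (L.path l)) ∧
      if L.ends k = {r, r + 1} ∨ L.ends k = {r + 2, r + 3} then l = k
      else L.ends l = (L.ends k)ᶜ := by
  obtain ⟨C, hC, hkC⟩ := (S.mem_strands.1 (L.path_mem k)).2
  obtain ⟨hCE, hcirc⟩ := (mem_covers.1 hD).1 C hC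
  rw [Finset.coe_subset] at hCE
  by_cases h : L.ends k = {r, r + 1} ∨ L.ends k = {r + 2, r + 3}
  · refine ⟨k, ?_, fun hne => absurd rfl hne, (if_pos h).symm ▸ rfl⟩
    rw [L.glue_joinPiece_eq hcirc hCE hkC hkC (fun hne => absurd rfl hne)]
    · exact hC
    · simpa only [joinPiece, Finset.pair_eq_singleton] using isEvenPiece_singleton h
  · obtain ⟨l, hlC, hdisj⟩ := L.exists_disjoint_path hD hC hkC h
    have hl := L.ends_eq_compl_of_disjoint hdisj
    refine ⟨l, ?_, fun _ => hdisj, (if_neg h).symm ▸ hl⟩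
    rw [L.glue_joinPiece_eq hcirc hCE hkC hlC (fun _ => hdisj)
      (isEvenPiece_pair (L.card_ends k) h hl)]
    exact hC

variable {π : Fin 4 → Fin 4}

lemma eq_glue_joinPiece (hD : D ∈ covers I (S.keeping r)) (hC : C ∈ D) (hk : L.path k ⊆ C)
    (hmem : L.glue (L.joinPiece r k l) ∈ D) : C = L.glue (L.joinPiece r k l) :=
  eq_of_isStrand_subset (S.containsOuter_keeping r) hD (L.isStrand k) hC hmem hk
    (L.path_subset_glue_joinPiece r k l)

lemma isJoining_of_glue_mem (hD : D ∈ covers I (S.keeping r))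
    (hmem : ∀ k, L.glue (L.joinPiece r k (π k)) ∈ D)
    (hdisj : ∀ k, k ≠ π k → Disjoint (L.path k) (L.path (π k)))
    (hπ : ∀ k, if L.ends k = {r, r + 1} ∨ L.ends k = {r + 2, r + 3} then π k = k
      else L.ends (π k) = (L.ends k)ᶜ) : IsJoining r L.ends π := by
  refine ⟨fun k => ?_, hπ⟩
  have hsub (k) : L.path (π k) ⊆ L.glue (L.joinPiece r k (π k)) :=
    L.path_subset_glue (by simp [joinPiece])
  have heq := L.eq_glue_joinPiece hD (hmem k) (hsub k) (hmem (π k))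
  have hπk : π (π k) ∈ ({k, π k} : Finset (Fin 4)) :=
    (L.path_subset_glue_iff (L.pieceDisjoint_pair (hdisj k))).1 (heq ▸ hsub (π k))
  rcases Finset.mem_insert.1 hπk with h | h
  · exact h
  rw [Finset.mem_singleton] at h
  by_cases hk : k = π k
  · rw [h, ← hk]
  · have hcompl := L.ends_eq_compl_of_disjoint (hdisj k hk)
    have hmatch := hπ k
    split_ifs at hmatch with hpair
    · exact absurd hmatch.symm hk
    · have hcross : ∀ (r : Fin 4) (m : Finset (Fin 4)), ¬ (m = {r, r + 1} ∨ m = {r + 2, r + 3}) →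
          ¬ (mᶜ = {r, r + 1} ∨ mᶜ = {r + 2, r + 3}) := by decide +kernel
      have hmatch' := hπ (π k)
      rw [h, hcompl, if_neg (hcross r _ hpair)] at hmatch'
      exact absurd hmatch' ne_compl_self

lemma eq_glueAll_joinPiece (hD : D ∈ covers I (S.keeping r))
    (hmem : ∀ k, L.glue (L.joinPiece r k (π k)) ∈ D) :
    D = L.glueAll (Finset.univ.image fun k => L.joinPiece r k (π k)) := by
  ext C
  simp only [mem_glueAll, Finset.mem_image, Finset.mem_univ, true_and, exists_exists_eq_and]
  constructor
  · intro hC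
    obtain ⟨hCE, hcirc⟩ := (mem_covers.1 hD).1 C hC
    rw [Finset.coe_subset] at hCE
    obtain ⟨g, hg, hge⟩ := S.exists_mem_notMem_range_e hcirc.prop.2 hcirc.prop.1 hCE
    obtain ⟨F, hFC, -, hF⟩ := S.exists_isStrand_mem
      (hCE.trans (S.containsOuter_keeping r).subset) hcirc.prop.2 hg hge
    have hFO : F ∈ S.strands D := S.mem_strands.2 ⟨hF, C, hC, hFC⟩
    rcases (S.endsOf F).eq_empty_or_nonempty with hends | hends
    · obtain rfl := hcirc.eq_of_le ⟨hF.prop.1, hF.prop.2.isEven hends⟩ hFC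
      exact Or.inl ⟨hFO, hends⟩
    · obtain ⟨k, rfl⟩ := L.exists_path_eq hFO hends
      exact Or.inr ⟨k, (L.eq_glue_joinPiece hD hC hFC (hmem k)).symm⟩
  · rintro (⟨hCO, hends⟩ | ⟨k, rfl⟩)
    · obtain ⟨hF, C', hC', hsub⟩ := S.mem_strands.1 hCO
      rwa [((mem_covers.1 hD).1 C' hC').2.eq_of_le ⟨hF.prop.1, hF.prop.2.isEven hends⟩ hsub]
    · exact hmem k

end Joining

/-- The relation of being disjoint, for the four outer paths. -/
noncomputable def disjointTable (L : S.PathLabelling O) (k l : Fin 4) : Bool :=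
  decide (Disjoint (L.path k) (L.path l))

lemma exists_disjointTable_eq_crossTable {t : Fin 6} (L : S.PathLabelling O)
    (ht : L.ends = pattern t) : ∃ a b c d, L.disjointTable = crossTable a b c d := by
  have hmeet : ∀ t, ∀ k l : Fin 4, (k < 2 ↔ l < 2) → ∃ i, i ∈ pattern t k ∧ i ∈ pattern t l := by
    decide
  have hfalse (k l : Fin 4) (hkl : k < 2 ↔ l < 2) : L.disjointTable k l = false := by
    obtain ⟨i, hik, hil⟩ := hmeet t k l hkl
    rw [← ht, L.mem_ends] at hik hil
    exact decide_eq_false fun hdisj => Finset.disjoint_left.1 hdisj hik hil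
  have hsymm (k l : Fin 4) : L.disjointTable k l = L.disjointTable l k := by
    simp only [disjointTable, disjoint_comm]
  refine ⟨L.disjointTable 0 2, L.disjointTable 0 3, L.disjointTable 1 2, L.disjointTable 1 3, ?_⟩
  ext k l
  fin_cases k <;> fin_cases l <;>
    first | exact hfalse _ _ (by decide) | rfl | exact hsymm _ _

lemma card_filter_strands_keeping_le (L : S.PathLabelling O) {J : Finset (Fin 4 → Fin 4)}
    (hJ : ∀ π, IsJoining r L.ends π → π ∈ J) :
    ((covers I (S.keeping r)).filter (S.strands · = O)).card ≤
      (J.filter (JoiningAllowed L.disjointTable)).card := by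
  refine le_trans (Finset.card_le_card fun D hD => ?_) (Finset.card_image_le
    (f := fun π => L.glueAll (Finset.univ.image fun k => L.joinPiece r k (π k))))
  obtain ⟨hcov, rfl⟩ := Finset.mem_filter.1 hD
  choose π hmem hdisj hπ using L.exists_partner hcov
  refine Finset.mem_image.2 ⟨π, Finset.mem_filter.2 ⟨hJ π ?_, ?_⟩,
    (L.eq_glueAll_joinPiece hcov hmem).symm⟩
  · exact L.isJoining_of_glue_mem hcov hmem hdisj hπ
  · exact fun k hk => decide_eq_true (hdisj k hk.symm)

lemma length_filter_le_card_filter_strands {t : Fin 6} (L : S.PathLabelling O)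
    (ht : L.ends = pattern t) :
    ((patternCovers t).filter (PieceAllowed L.disjointTable)).length ≤
      ((covers I E).filter (S.strands · = O)).card := by
  set K := (patternCovers t).filter (PieceAllowed L.disjointTable)
  have hcover (X) (hX : X ∈ K) : IsPieceCover L.ends X :=
    ht ▸ isPieceCover_of_mem t X (List.mem_of_mem_filter hX)
  have hdisj (X) (hX : X ∈ K) (p) (hp : p ∈ X) : L.PieceDisjoint p := fun k hk l hl hkl =>
    of_decide_eq_true (of_decide_eq_true (List.mem_filter.1 hX).2 p hp k hk l hl hkl)
  have hpiece (X) (hX : X ∈ K) (p) (hp : p ∈ X.toFinset) : p ≠ (∅, ∅) ∧ L.PieceDisjoint p := by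
    rw [List.mem_toFinset] at hp
    exact ⟨((hcover X hX).isCircuitPiece p hp).1, hdisj X hX p hp⟩
  have hnodup : ((K.map List.toFinset).map L.glueAll).Nodup := by
    refine List.Nodup.map_on (fun X hX Y hY hXY => ?_) ((nodup_map_toFinset_patternCovers t).sublist
      (List.Sublist.map _ List.filter_sublist))
    obtain ⟨X, hXK, rfl⟩ := List.mem_map.1 hX
    obtain ⟨Y, hYK, rfl⟩ := List.mem_map.1 hY
    exact L.glueAll_inj (hpiece X hXK) (hpiece Y hYK) hXY
  have hlength : ((K.map List.toFinset).map L.glueAll).length = K.length := by simp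
  rw [← hlength, ← List.toFinset_card_of_nodup hnodup]
  refine Finset.card_le_card fun D hD => ?_
  simp only [List.mem_toFinset, List.map_map, List.mem_map, Function.comp_apply] at hD
  obtain ⟨X, hX, rfl⟩ := hD
  exact Finset.mem_filter.2 ⟨L.glueAll_mem_covers (hcover X hX) (hdisj X hX),
    L.strands_glueAll (hcover X hX) (hdisj X hX)⟩

end PathLabelling

lemma card_filter_strands_le (S : Square I E) (O : Finset (Finset β)) :
    2 * ((covers I (S.keeping 0)).filter (S.strands · = O)).card +
      2 * ((covers I (S.keeping 1)).filter (S.strands · = O)).card ≤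
      ((covers I E).filter (S.strands · = O)).card := by
  by_cases hO : S.IsStrandCover O
  · obtain ⟨t, L, ht⟩ := hO.exists_pathLabelling
    have hzero := L.card_filter_strands_keeping_le (r := 0) (J := joiningsZero t)
      fun π hπ => (ht ▸ hπ).mem_joiningsZero
    have hone := L.card_filter_strands_keeping_le (r := 1) (J := joiningsOne t)
      fun π hπ => (ht ▸ hπ).mem_joiningsOne
    have hboth := L.length_filter_le_card_filter_strands ht
    obtain ⟨a, b, c, d, htable⟩ := L.exists_disjointTable_eq_crossTable ht
    rw [htable] at hzero hone hboth
    have := card_joinings_le t a b c d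
    omega
  · have hempty (r : Fin 4) : (covers I (S.keeping r)).filter (S.strands · = O) = ∅ := by
      refine Finset.filter_false_of_mem fun D hD hDO => hO ?_
      exact hDO ▸ isStrandCover_strands (S.containsOuter_keeping r) hD
    simp [hempty]

theorem card_covers_le (S : Square I E) :
    2 * (covers I (S.keeping 0)).card + 2 * (covers I (S.keeping 1)).card ≤
      (covers I E).card := by
  have hfibers (E' : Finset β) : (covers I E').card = ∑ O ∈ E.powerset.powerset,
      ((covers I E').filter (S.strands · = O)).card :=
    Finset.card_eq_sum_card_fiberwise fun D _ =>
      Finset.mem_coe.2 (Finset.mem_powerset.2 (Finset.filter_subset _ _))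
  rw [hfibers, hfibers, hfibers, Finset.mul_sum, Finset.mul_sum, ← Finset.sum_add_distrib]
  exact Finset.sum_le_sum fun O _ => S.card_filter_strands_le O

lemma nodup_of_isDoubleCover {D : Multiset (Finset β)} (hD : IsDoubleCover I (S.keeping r) D) :
    D.Nodup := by
  refine Multiset.nodup_iff_count_le_one.2 fun C => ?_
  by_cases hC : C ∈ D
  · obtain ⟨hCE, hcircuit⟩ := hD.1 C hC
    obtain ⟨g, hg, hge⟩ :=
      S.exists_mem_notMem_range_e hcircuit.prop.2 hcircuit.prop.1 (Finset.coe_subset.1 hCE)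
    calc D.count C ≤ D.countP (C ⊆ ·) := countP_le_countP D fun F hF => hF.subset
      _ ≤ 1 := countP_superset_le_one (S.containsOuter_keeping r) hD hg
        (Finset.sdiff_subset (hCE hg)) hge fun x _ => hcircuit.prop.2 x
  · exact (Multiset.count_eq_zero_of_notMem hC).trans_le zero_le_one

lemma encard_isDoubleCover_le (S : Square I E) (r : Fin 4) :
    {D | IsDoubleCover I (S.keeping r) D}.encard ≤ (covers I (S.keeping r)).card := by
  rw [← Set.encard_coe_eq_coe_finsetCard]
  refine (Set.encard_le_encard fun D hD => ?_).trans (Set.encard_image_le Finset.val _)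
  exact ⟨⟨D, nodup_of_isDoubleCover hD⟩, mem_covers.2 hD, rfl⟩

end Square

/-! ### Subdivision -/

section Subdivision

variable {α β γ : Type*}

lemma injOn_multiset_map {f : β → γ} {s : Set β} (hf : Set.InjOn f s) :
    Set.InjOn (Multiset.map f) {D | ∀ a ∈ D, a ∈ s} := by
  intro D hD D' hD' heq
  rcases isEmpty_or_nonempty β with hβ | hβ
  · exact Subsingleton.elim D D'
  have hleft (D : Multiset β) (hD : ∀ a ∈ D, a ∈ s) :
      (D.map f).map (Function.invFunOn f s) = D := by
    rw [Multiset.map_map]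
    exact (Multiset.map_congr rfl fun a ha => hf.leftInvOn_invFunOn (hD a ha)).trans D.map_id
  rw [← hleft D hD, heq, hleft D' hD']

variable {I I' : β → α → Prop} {F : Finset β} {x : α} {e f : β} {v : α}

lemma isEven_congr {J : β → α → Prop} (h : ∀ g ∈ F, ∀ x, I g x ↔ J g x) :
    IsEven I F ↔ IsEven J F :=
  forall_congr' fun x => by rw [boundary_congr fun g hg => h g hg x]

lemma isCircuitSet_congr {J : β → α → Prop} (h : ∀ g ∈ F, ∀ x, I g x ↔ J g x) :
    IsCircuitSet I F ↔ IsCircuitSet J F := by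
  simp only [IsCircuitSet, minimal_iff, isEven_congr h]
  refine and_congr_right fun _ => forall_congr' fun F' => ?_
  have hcongr (hF' : F' ⊆ F) := isEven_congr fun g hg => h g (hF' hg)
  exact ⟨fun hmin hF' hle => hmin ⟨hF'.1, (hcongr hle).2 hF'.2⟩ hle,
    fun hmin hF' hle => hmin ⟨hF'.1, (hcongr hle).1 hF'.2⟩ hle⟩

lemma boundary_eq_of_inc_iff (hef : e ≠ f) (hx : ∀ g, I g x ↔ g = e ∨ g = f) (F : Finset β) :
    boundary I F x = (if e ∈ F then 1 else 0) + (if f ∈ F then 1 else 0) := by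
  have hsplit (g : β) : (if I g x then (1 : ZMod 2) else 0) =
      (if g = e then 1 else 0) + (if g = f then 1 else 0) := by
    rw [if_congr (hx g) rfl rfl]
    by_cases hge : g = e
    · simp [hge, hef]
    · simp [hge]
  simp only [boundary, hsplit, Finset.sum_add_distrib, Finset.sum_ite_eq']

lemma boundary_eq_zero_iff_of_inc_iff (hef : e ≠ f) (hx : ∀ g, I g x ↔ g = e ∨ g = f) :
    boundary I F x = 0 ↔ (e ∈ F ↔ f ∈ F) := by
  rw [boundary_eq_of_inc_iff hef hx]
  by_cases he : e ∈ F <;> by_cases hf : f ∈ F <;> simp [he, hf, CharTwo.add_self_eq_zero]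

/-- The incidence relation `I` arises from `I'` by subdividing the edge `e` at the new vertex `v`
into two edges, one of which keeps the label `e` while the other is labelled `f`. The symmetric
difference in `inc_new` allows for the two edges being parallel, in which case `e` is a loop
before the subdivision. -/
structure IsSubdivision (I I' : β → α → Prop) (e f : β) (v : α) : Prop where
  ne : e ≠ f
  inc_vertex : ∀ g, I g v ↔ g = e ∨ g = f
  inc_new : ∀ z, I' e z ↔ Xor (I e z) (I f z)
  inc_of_ne : ∀ g z, g ≠ e → g ≠ f → (I' g z ↔ I g z)

/-- The edge set obtained from `F` when the edge `e` is subdivided into `e` and `f`. -/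
noncomputable def subdivide (e f : β) (F : Finset β) : Finset β :=
  if e ∈ F then insert f F else F

lemma mem_subdivide_of_ne {g : β} (hg : g ≠ f) : g ∈ subdivide e f F ↔ g ∈ F := by
  by_cases he : e ∈ F <;> simp [subdivide, he, hg]

lemma mem_subdivide_self (hf : f ∉ F) : f ∈ subdivide e f F ↔ e ∈ F := by
  by_cases he : e ∈ F <;> simp [subdivide, he, hf]

lemma erase_subdivide (hf : f ∉ F) : (subdivide e f F).erase f = F := by
  by_cases he : e ∈ F <;> simp [subdivide, he, hf]

lemma injOn_subdivide : Set.InjOn (subdivide e f) {F | f ∉ F} := fun F hF F' hF' heq => by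
  rw [← erase_subdivide hF, heq, erase_subdivide hF']

namespace IsSubdivision

lemma boundary_subdivide (h : IsSubdivision I I' e f v) (hf : f ∉ F) (z : α) :
    boundary I (subdivide e f F) z = boundary I' F z := by
  by_cases he : e ∈ F
  · have hrest : boundary I (F.erase e) z = boundary I' (F.erase e) z :=
      boundary_congr fun g hg => (h.inc_of_ne g z (Finset.ne_of_mem_erase hg)
        fun hgf => hf (hgf ▸ Finset.mem_of_mem_erase hg)).symm
    have hsplit (J : β → α → Prop) :
        boundary J F z = (if J e z then 1 else 0) + boundary J (F.erase e) z :=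
      (Finset.add_sum_erase F _ he).symm
    have hnew : (if I f z then (1 : ZMod 2) else 0) + (if I e z then 1 else 0) =
        if I' e z then 1 else 0 := by
      rw [if_congr (h.inc_new z) rfl rfl]
      by_cases hez : I e z <;> by_cases hfz : I f z <;>
        simp [hez, hfz, Xor, CharTwo.add_self_eq_zero]
    rw [subdivide, if_pos he, Finset.insert_eq, boundary_union (by simpa using hf),
      boundary_singleton, hsplit, hsplit, hrest, ← add_assoc, hnew]
  · rw [subdivide, if_neg he]
    exact boundary_congr fun g hg =>
      (h.inc_of_ne g z (fun hge => he (hge ▸ hg)) fun hgf => hf (hgf ▸ hg)).symm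

lemma subdivide_erase (h : IsSubdivision I I' e f v) (hF : IsEven I F) :
    subdivide e f (F.erase f) = F := by
  have hiff := (boundary_eq_zero_iff_of_inc_iff h.ne h.inc_vertex).1 (hF v)
  by_cases he : e ∈ F
  · simp [subdivide, he, h.ne, Finset.insert_erase (hiff.1 he)]
  · simp [subdivide, he, Finset.erase_eq_of_notMem (mt hiff.2 he)]

lemma isCircuitSet_subdivide (h : IsSubdivision I I' e f v) (hf : f ∉ F)
    (hF : IsCircuitSet I' F) : IsCircuitSet I (subdivide e f F) := by
  have hsub : F ⊆ subdivide e f F := fun g hg =>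
    (mem_subdivide_of_ne (ne_of_mem_of_not_mem hg hf)).2 hg
  refine minimal_iff.2 ⟨⟨hF.prop.1.mono hsub, fun z => ?_⟩, fun K hK hle => ?_⟩
  · rw [h.boundary_subdivide hf, hF.prop.2 z]
  have hKf : K.erase f ⊆ F := (Finset.erase_subset_erase f hle).trans_eq (erase_subdivide hf)
  have hne : (K.erase f).Nonempty := by
    rw [Finset.nonempty_iff_ne_empty]
    intro hempty
    have hK' := h.subdivide_erase hK.2
    rw [hempty] at hK'
    exact hK.1.ne_empty (hK'.symm.trans (by simp [subdivide]))
  have heven : IsEven I' (K.erase f) := fun z => by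
    rw [← h.boundary_subdivide (Finset.notMem_erase f K), h.subdivide_erase hK.2, hK.2 z]
  rw [← h.subdivide_erase hK.2, hF.eq_of_le ⟨hne, heven⟩ hKf]

lemma isDoubleCover_map (h : IsSubdivision I I' e f v) {E : Set β} {D : Multiset (Finset β)}
    (he : e ∈ E) (hf : f ∈ E) (hD : IsDoubleCover I' (E \ {f}) D) :
    IsDoubleCover I E (D.map (subdivide e f)) := by
  have hDf : ∀ F ∈ D, f ∉ F := fun F hF hfF => ((hD.1 F hF).1 hfF).2 rfl
  refine ⟨fun K hK => ?_, fun g hg => ?_⟩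
  · obtain ⟨F, hF, rfl⟩ := Multiset.mem_map.1 hK
    refine ⟨fun g hg => ?_, h.isCircuitSet_subdivide (hDf F hF) (hD.1 F hF).2⟩
    rcases eq_or_ne g f with rfl | hgf
    · exact hf
    · exact ((hD.1 F hF).1 ((mem_subdivide_of_ne hgf).1 hg)).1
  · rw [Multiset.countP_map, ← Multiset.countP_eq_card_filter]
    rcases eq_or_ne g f with rfl | hgf
    · rw [← hD.2 e ⟨he, h.ne⟩]
      exact Multiset.countP_congr rfl fun F hF => propext (mem_subdivide_self (hDf F hF))
    · rw [← hD.2 g ⟨hg, hgf⟩]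
      exact Multiset.countP_congr rfl fun F _ => propext (mem_subdivide_of_ne hgf)

lemma encard_isDoubleCover_le (h : IsSubdivision I I' e f v) {E : Set β} (he : e ∈ E)
    (hf : f ∈ E) :
    {D | IsDoubleCover I' (E \ {f}) D}.encard ≤ {D | IsDoubleCover I E D}.encard :=
  Set.encard_le_encard_of_injOn (fun _ hD => h.isDoubleCover_map he hf hD)
    ((injOn_multiset_map injOn_subdivide).mono
      fun _ hD F hF hfF => ((hD.1 F hF).1 hfF).2 rfl)

end IsSubdivision

end Subdivision

open Graph

/-! ### Circuits of multigraphs as edge sets -/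

section GraphCovers

variable {α β : Type*} {G H H' C C' : Graph α β} {x y : α} {g : β} {F : Finset β}

lemma inc_iff_isNonloopAt_or_isLoopAt : G.Inc g x ↔ G.IsNonloopAt g x ∨ G.IsLoopAt g x :=
  ⟨fun h => h.isLoopAt_or_isNonloopAt.symm, fun h => h.elim IsNonloopAt.inc IsLoopAt.inc⟩

lemma deg_eq_encard_isNonloopAt_add (G : Graph α β) (x : α) :
    G.deg x = {g | G.IsNonloopAt g x}.encard + 2 * (G.loopSet x).encard := by
  have hunion : G.incidenceSet x = {g | G.IsNonloopAt g x} ∪ G.loopSet x :=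
    Set.ext fun g => inc_iff_isNonloopAt_or_isLoopAt
  have hdisj : Disjoint {g | G.IsNonloopAt g x} (G.loopSet x) :=
    Set.disjoint_left.2 fun g hg hg' => hg.not_isLoopAt x hg'
  rw [deg, hunion, Set.encard_union_eq hdisj, add_assoc, two_mul]

lemma finite_incidenceSet (h : G.deg x ≠ ⊤) : (G.incidenceSet x).Finite := by
  rw [← Set.encard_ne_top_iff]
  exact fun htop => h (by rw [deg, htop, top_add])

lemma finite_edgeSet (hV : G.vertexSet.Finite) (h : ∀ x ∈ G.vertexSet, G.deg x ≠ ⊤) :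
    G.edgeSet.Finite := by
  refine (hV.biUnion fun x hx => finite_incidenceSet (h x hx)).subset fun g hg => ?_
  obtain ⟨x, y, hxy⟩ := exists_isLink_of_mem_edgeSet hg
  exact Set.mem_biUnion hxy.left_mem hxy.inc_left

lemma ncard_add_ncard_of_deg_eq {n : ℕ} (h : G.deg x = n) :
    {g | G.IsNonloopAt g x}.ncard + 2 * (G.loopSet x).ncard = n := by
  have hfin := finite_incidenceSet (h.trans_ne (ENat.natCast_ne_top n))
  rw [deg_eq_encard_isNonloopAt_add, ← (hfin.subset fun g hg => hg.inc).cast_ncard_eq,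
    ← (hfin.subset (loopSet_subset_incidenceSet x)).cast_ncard_eq] at h
  exact_mod_cast h

lemma deg_eq_two_cases (h : G.deg x = 2) :
    (∃ a b, a ≠ b ∧ (∀ g, G.IsNonloopAt g x ↔ g = a ∨ g = b) ∧ ∀ g, ¬ G.IsLoopAt g x) ∨
      ∃ a, (∀ g, G.IsLoopAt g x ↔ g = a) ∧ ∀ g, ¬ G.IsNonloopAt g x := by
  have hfin := finite_incidenceSet (h.trans_ne (ENat.natCast_ne_top 2))
  have hsum := ncard_add_ncard_of_deg_eq (n := 2) h
  rcases (show (G.loopSet x).ncard = 0 ∨ (G.loopSet x).ncard = 1 by omega) with h0 | h1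
  · obtain ⟨a, b, hab, hset⟩ := Set.ncard_eq_two.1 (show {g | G.IsNonloopAt g x}.ncard = 2 by omega)
    rw [Set.ncard_eq_zero (hfin.subset (loopSet_subset_incidenceSet x))] at h0
    exact Or.inl ⟨a, b, hab, Set.ext_iff.1 hset, Set.eq_empty_iff_forall_notMem.1 h0⟩
  · obtain ⟨a, hset⟩ := Set.ncard_eq_one.1 h1
    have hempty := (Set.ncard_eq_zero (hfin.subset fun g (hg : G.IsNonloopAt g x) => hg.inc)).1
      (show {g | G.IsNonloopAt g x}.ncard = 0 by omega)
    exact Or.inr ⟨a, Set.ext_iff.1 hset, Set.eq_empty_iff_forall_notMem.1 hempty⟩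

lemma isNonloopAt_iff_of_deg_eq_two {e f : β} (h : G.deg x = 2) (hef : e ≠ f)
    (he : G.Inc e x) (hf : G.Inc f x) : G.IsNonloopAt g x ↔ g = e ∨ g = f := by
  rw [inc_iff_isNonloopAt_or_isLoopAt] at he hf
  rcases deg_eq_two_cases h with ⟨a, b, -, hnonloop, hnone⟩ | ⟨a, hloop, hnone⟩
  · simp only [hnonloop, hnone, or_false] at he hf ⊢
    grind
  · simp only [hloop, hnone, false_or] at he hf
    exact absurd (he.trans hf.symm) hef

lemma exists_isClaw_of_deg_eq_three (h : G.deg x = 3) (hloop : ∀ g, ¬ G.IsLoopAt g x) :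
    ∃ a b c, IsClaw G.IsNonloopAt x a b c := by
  have hsum := ncard_add_ncard_of_deg_eq (n := 3) h
  have hempty : G.loopSet x = ∅ := Set.eq_empty_iff_forall_notMem.2 hloop
  rw [hempty, Set.ncard_empty] at hsum
  obtain ⟨a, b, c, hab, hac, hbc, hset⟩ := Set.ncard_eq_three.1 hsum
  exact ⟨a, b, c, hab, hac, hbc, Set.ext_iff.1 hset⟩

lemma exists_isNonloopAt_iff_eq_of_deg_eq_three (h : G.deg x = 3) (hloop : G.IsLoopAt g x) :
    ∃ b, ∀ k, G.IsNonloopAt k x ↔ k = b := by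
  have hfin := (finite_incidenceSet (h.trans_ne (ENat.natCast_ne_top 3))).subset
    (loopSet_subset_incidenceSet x)
  have hpos := (Set.ncard_pos hfin).2 ⟨g, hloop⟩
  have hsum := ncard_add_ncard_of_deg_eq (n := 3) h
  obtain ⟨b, hset⟩ := Set.ncard_eq_one.1 (show {g | G.IsNonloopAt g x}.ncard = 1 by omega)
  exact ⟨b, Set.ext_iff.1 hset⟩

lemma isNonloopAt_iff_of_isLink {z : α} (h : G.IsLink g x y) (hxy : x ≠ y) :
    G.IsNonloopAt g z ↔ z = x ∨ z = y := by
  refine ⟨fun hz => hz.inc.eq_or_eq_of_isLink h, ?_⟩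
  rintro (rfl | rfl)
  exacts [⟨y, hxy.symm, h⟩, ⟨x, hxy, h.symm⟩]

/-- The finite set of the edges of a graph (`∅` if there are infinitely many). -/
noncomputable def edgeFinset (C : Graph α β) : Finset β :=
  if h : C.edgeSet.Finite then h.toFinset else ∅

lemma mem_edgeFinset (h : C.edgeSet.Finite) : g ∈ edgeFinset C ↔ g ∈ C.edgeSet := by
  simp [edgeFinset, h]

lemma finite_edgeSet_of_isCircuit (h : C.IsCircuit) : C.edgeSet.Finite :=
  finite_edgeSet h.1 fun x hx => (h.2.2 x hx).trans_ne (ENat.natCast_ne_top 2)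

lemma exists_inc_of_isCircuit (h : C.IsCircuit) (hx : x ∈ C.vertexSet) : ∃ g, C.Inc g x := by
  rcases deg_eq_two_cases (h.2.2 x hx) with ⟨a, b, -, hnonloop, -⟩ | ⟨a, hloop, -⟩
  · exact ⟨a, ((hnonloop a).2 (Or.inl rfl)).inc⟩
  · exact ⟨a, ((hloop a).2 rfl).inc⟩

lemma isEven_edgeFinset (h : C.IsCircuit) : IsEven C.IsNonloopAt (edgeFinset C) := by
  intro x
  by_cases hx : x ∈ C.vertexSet
  · rcases deg_eq_two_cases (h.2.2 x hx) with ⟨a, b, hab, hnonloop, -⟩ | ⟨-, -, hnone⟩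
    · have hmem (g : β) (hg : g = a ∨ g = b) : g ∈ edgeFinset C :=
        (mem_edgeFinset (finite_edgeSet_of_isCircuit h)).2 ((hnonloop g).2 hg).edge_mem
      exact (boundary_eq_zero_iff_of_inc_iff hab hnonloop).2
        (iff_of_true (hmem a (Or.inl rfl)) (hmem b (Or.inr rfl)))
    · exact boundary_eq_zero_of_forall_not fun g _ => hnone g
  · exact boundary_eq_zero_of_forall_not fun g _ hg => hx hg.vertex_mem

lemma mem_of_isEven_of_inc {k : β} (hF : IsEven C.IsNonloopAt F) (hdeg : C.deg x = 2)
    (hg : g ∈ F) (hgx : C.Inc g x) (hkx : C.Inc k x) : k ∈ F := by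
  rw [inc_iff_isNonloopAt_or_isLoopAt] at hgx hkx
  rcases deg_eq_two_cases hdeg with ⟨a, b, hab, hnonloop, hnone⟩ | ⟨a, hloop, hnone⟩
  · have hiff := (boundary_eq_zero_iff_of_inc_iff hab hnonloop).1 (hF x)
    simp only [hnonloop, hnone, or_false] at hgx hkx
    rcases hgx with rfl | rfl <;> rcases hkx with rfl | rfl <;> simp_all
  · simp only [hloop, hnone, false_or] at hgx hkx
    rwa [hkx, ← hgx]

lemma edgeFinset_subset_of_isEven (h : C.IsCircuit) (hne : F.Nonempty)
    (hsub : ↑F ⊆ C.edgeSet) (hF : IsEven C.IsNonloopAt F) : edgeFinset C ⊆ F := by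
  have hlocal {x : α} (hx : ∃ g ∈ F, C.Inc g x) (k : β) (hk : C.Inc k x) : k ∈ F := by
    obtain ⟨g, hg, hgx⟩ := hx
    exact mem_of_isEven_of_inc hF (h.2.2 x hk.vertex_mem) hg hgx hk
  obtain ⟨g₀, hg₀⟩ := hne
  obtain ⟨x₀, y₀, hxy⟩ := exists_isLink_of_mem_edgeSet (hsub hg₀)
  have hreach (y : α) (hy : Relation.ReflTransGen C.Adj x₀ y) : ∃ g ∈ F, C.Inc g y := by
    induction hy with
    | refl => exact ⟨g₀, hg₀, hxy.inc_left⟩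
    | tail _ hyz ih =>
      obtain ⟨k, hk⟩ := hyz
      exact ⟨k, hlocal ih k hk.inc_left, hk.inc_right⟩
  intro g hg
  obtain ⟨x, y, hgxy⟩ :=
    exists_isLink_of_mem_edgeSet ((mem_edgeFinset (finite_edgeSet_of_isCircuit h)).1 hg)
  exact hlocal (hreach x (h.2.1.2 x₀ hxy.left_mem x hgxy.left_mem)) g hgxy.inc_left

lemma isCircuitSet_edgeFinset (h : C.IsCircuit) (hCH : C ≤ H) :
    IsCircuitSet H.IsNonloopAt (edgeFinset C) := by
  have hmem {g : β} := mem_edgeFinset (g := g) (finite_edgeSet_of_isCircuit h)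
  rw [isCircuitSet_congr fun g hg x => (hCH.isNonloopAt_congr (hmem.1 hg)).symm]
  obtain ⟨x, hx⟩ := h.2.1.1
  obtain ⟨g, hg⟩ := exists_inc_of_isCircuit h hx
  exact ⟨⟨⟨g, hmem.2 hg.edge_mem⟩, isEven_edgeFinset h⟩, fun F hF hle =>
    edgeFinset_subset_of_isEven h hF.1 (fun k hk => hmem.1 (hle hk)) hF.2⟩

lemma vertexSet_subset_of_edgeSet_eq (h : C.IsCircuit) (hE : C.edgeSet = C'.edgeSet)
    (hcomp : C.Compatible C') : C.vertexSet ⊆ C'.vertexSet := by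
  intro x hx
  obtain ⟨g, hg⟩ := exists_inc_of_isCircuit h hx
  exact (hg.of_compatible hcomp (hE ▸ hg.edge_mem)).vertex_mem

lemma injOn_edgeFinset (H : Graph α β) : Set.InjOn edgeFinset {C | C ≤ H ∧ C.IsCircuit} := by
  rintro C ⟨hCH, hC⟩ C' ⟨hCH', hC'⟩ heq
  have hE : C.edgeSet = C'.edgeSet := by
    ext g
    rw [← mem_edgeFinset (finite_edgeSet_of_isCircuit hC), heq,
      mem_edgeFinset (finite_edgeSet_of_isCircuit hC')]
  have hcomp := Compatible.of_le_le hCH hCH'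
  exact hcomp.ext ((vertexSet_subset_of_edgeSet_eq hC hE hcomp).antisymm
    (vertexSet_subset_of_edgeSet_eq hC' hE.symm hcomp.symm)) hE

lemma nu_le_encard_isDoubleCover (H : Graph α β) :
    H.nu ≤ {D | IsDoubleCover H.IsNonloopAt H.edgeSet D}.encard := by
  refine Set.encard_le_encard_of_injOn (f := Multiset.map edgeFinset) (fun 𝒞 h𝒞 => ?_)
    ((injOn_multiset_map (injOn_edgeFinset H)).mono fun 𝒞 h𝒞 => h𝒞.1)
  refine ⟨fun F hF => ?_, fun g hg => ?_⟩
  · obtain ⟨C, hC, rfl⟩ := Multiset.mem_map.1 hF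
    obtain ⟨hCH, hcircuit⟩ := h𝒞.1 C hC
    exact ⟨fun g hg =>
      hCH.edgeSet_mono ((mem_edgeFinset (finite_edgeSet_of_isCircuit hcircuit)).1 hg),
      isCircuitSet_edgeFinset hcircuit hCH⟩
  · rw [Multiset.countP_map, ← Multiset.countP_eq_card_filter, ← h𝒞.2 g hg]
    exact Multiset.countP_congr rfl fun C hC =>
      propext (mem_edgeFinset (finite_edgeSet_of_isCircuit (h𝒞.1 C hC).2))

lemma exists_isSubdivision_of_suppressStep (h : SuppressStep H H') :
    ∃ v, ∃ e ∈ H.edgeSet, ∃ f ∈ H.edgeSet, IsSubdivision H.IsNonloopAt H'.IsNonloopAt e f v ∧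
      H'.edgeSet = H.edgeSet \ {f} := by
  obtain ⟨v, x, y, e, f, hdeg, hef, hev, hfv, -, hlink⟩ := h
  have hnonloop (g : β) : H.IsNonloopAt g v ↔ g = e ∨ g = f :=
    isNonloopAt_iff_of_deg_eq_two hdeg hef hev.inc_left hfv.inc_left
  have hother (g : β) (z : α) (hge : g ≠ e) (hgf : g ≠ f) :
      H'.IsNonloopAt g z ↔ H.IsNonloopAt g z := by
    simp only [IsNonloopAt, hlink, hge, hgf, ne_eq, false_and, not_false_eq_true, true_and,
      false_or]
  have hvx : v ≠ x := by
    rintro rfl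
    exact ((hnonloop e).2 (Or.inl rfl)).not_isLoopAt _ hev
  have hvy : v ≠ y := by
    rintro rfl
    exact ((hnonloop f).2 (Or.inr rfl)).not_isLoopAt _ hfv
  have hnew (z : α) : H'.IsNonloopAt e z ↔ Xor (H.IsNonloopAt e z) (H.IsNonloopAt f z) := by
    rw [isNonloopAt_iff_of_isLink hev hvx, isNonloopAt_iff_of_isLink hfv hvy]
    have hxy : H'.IsLink e x y := (hlink e x y).2 (Or.inl ⟨rfl, Or.inl ⟨rfl, rfl⟩⟩)
    rcases eq_or_ne x y with rfl | hne
    · simp only [xor_self, iff_false]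
      exact fun hz => hz.not_isLoopAt _ hxy
    · rw [isNonloopAt_iff_of_isLink hxy hne]
      grind [Xor]
  refine ⟨v, e, hev.edge_mem, f, hfv.edge_mem, ⟨hef, hnonloop, hnew, hother⟩, Set.ext fun g => ?_⟩
  simp only [edge_mem_iff_exists_isLink, hlink, Set.mem_sdiff, Set.mem_singleton_iff]
  constructor
  · rintro ⟨p, q, ⟨rfl, -⟩ | ⟨-, hgf, hpq⟩⟩
    exacts [⟨⟨v, x, hev⟩, hef⟩, ⟨⟨p, q, hpq⟩, hgf⟩]
  · rintro ⟨⟨p, q, hpq⟩, hgf⟩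
    by_cases hge : g = e
    · exact ⟨x, y, Or.inl ⟨hge, Or.inl ⟨rfl, rfl⟩⟩⟩
    · exact ⟨p, q, Or.inr ⟨hge, hgf, hpq⟩⟩

lemma nu_le_encard_of_isSuppressionOf (h : H'.IsSuppressionOf H) :
    H'.nu ≤ {D | IsDoubleCover H.IsNonloopAt H.edgeSet D}.encard := by
  refine (nu_le_encard_isDoubleCover H').trans ?_
  obtain ⟨hsteps, -⟩ := h
  induction hsteps with
  | refl => exact le_rfl
  | tail _ hstep ih =>
    obtain ⟨v, e, he, f, hf, hsub, hE⟩ := exists_isSubdivision_of_suppressStep hstep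
    rw [hE]
    exact (hsub.encard_isDoubleCover_le he hf).trans ih

end GraphCovers

section OfEdges

variable {α β : Type*} {I : β → α → Prop} {G : Graph α β} {x : α} {g b : β} {F : Finset β}

lemma notMem_of_isEven_of_inc_iff_eq (hF : IsEven I F) (hx : ∀ g, I g x ↔ g = b) : b ∉ F := by
  intro hb
  have hbd : boundary I F x = 1 := by simp [boundary, hx, hb]
  exact zero_ne_one ((hF x).symm.trans hbd)

/-- The subgraph formed by a set of edges and their ends. -/
def ofEdges (G : Graph α β) (F : Finset β) : Graph α β :=
  (G.restrict F).induce {x | ∃ g ∈ F, G.Inc g x}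

lemma ofEdges_isLink {y : α} : (ofEdges G F).IsLink g x y ↔ g ∈ F ∧ G.IsLink g x y :=
  ⟨fun h => h.1, fun h => ⟨h, ⟨g, h.1, h.2.inc_left⟩, g, h.1, h.2.inc_right⟩⟩

lemma ofEdges_inc : (ofEdges G F).Inc g x ↔ g ∈ F ∧ G.Inc g x := by
  simp only [Inc, ofEdges_isLink, exists_and_left]

lemma ofEdges_isLoopAt : (ofEdges G F).IsLoopAt g x ↔ g ∈ F ∧ G.IsLoopAt g x :=
  ofEdges_isLink

lemma ofEdges_le (G : Graph α β) (F : Finset β) : ofEdges G F ≤ G :=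
  ⟨fun _ ⟨_, _, h⟩ => h.vertex_mem, fun _ _ _ h => (ofEdges_isLink.1 h).2⟩

lemma edgeSet_ofEdges (hF : ↑F ⊆ G.edgeSet) : (ofEdges G F).edgeSet = ↑F := by
  ext g
  simp only [edge_mem_iff_exists_isLink, ofEdges_isLink, exists_and_left, Finset.mem_coe,
    and_iff_left_iff_imp]
  exact fun hg => exists_isLink_of_mem_edgeSet (hF hg)

lemma edgeFinset_ofEdges (hF : ↑F ⊆ G.edgeSet) : edgeFinset (ofEdges G F) = F := by
  have hE := edgeSet_ofEdges hF
  ext g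
  rw [mem_edgeFinset (hE ▸ F.finite_toSet), hE, Finset.mem_coe]

lemma reflTransGen_ofEdges_of_inc {y z : α} (hg : g ∈ F) (hy : G.Inc g y) (hz : G.Inc g z) :
    Relation.ReflTransGen (ofEdges G F).Adj y z := by
  obtain ⟨w, hyw⟩ := hy
  rcases hz.eq_or_eq_of_isLink hyw with rfl | rfl
  · exact .refl
  · exact .single ⟨g, ofEdges_isLink.2 ⟨hg, hyw⟩⟩

-- The edges of `F` in the component of a vertex form an even set, which is `F` by minimality.
lemma isConnected_ofEdges (hF : ↑F ⊆ G.edgeSet) (hcircuit : IsCircuitSet G.IsNonloopAt F) :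
    (ofEdges G F).IsConnected := by
  obtain ⟨g₀, hg₀⟩ := hcircuit.prop.1
  obtain ⟨x₀, y₀, hlink⟩ := exists_isLink_of_mem_edgeSet (hF hg₀)
  refine ⟨⟨x₀, g₀, hg₀, hlink.inc_left⟩, ?_⟩
  rintro x ⟨gx, hgx, hx⟩ y ⟨gy, hgy, hy⟩
  set R := Relation.ReflTransGen (ofEdges G F).Adj x
  have hstep {g : β} {z w : α} (hg : g ∈ F) (hz : R z) (hgz : G.Inc g z) (hgw : G.Inc g w) :
      R w := hz.trans (reflTransGen_ofEdges_of_inc hg hgz hgw)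
  have heven : IsEven G.IsNonloopAt (F.filter fun g => ∃ z, R z ∧ G.Inc g z) := by
    intro w
    by_cases hw : R w
    · rw [← hcircuit.prop.2 w, boundary, Finset.sum_filter]
      refine Finset.sum_congr rfl fun g _ => ?_
      by_cases hgw : G.IsNonloopAt g w
      · rw [if_pos ⟨w, hw, hgw.inc⟩]
      · simp [hgw]
    · refine boundary_eq_zero_of_forall_not fun g hg hgw => hw ?_
      obtain ⟨hg, z, hz, hgz⟩ := Finset.mem_filter.1 hg
      exact hstep hg hz hgz hgw.inc
  have hall := hcircuit.eq_of_le
    ⟨⟨gx, Finset.mem_filter.2 ⟨hgx, x, .refl, hx⟩⟩, heven⟩ (Finset.filter_subset _ _)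
  rw [← hall] at hgy
  obtain ⟨hgy, z, hz, hgz⟩ := Finset.mem_filter.1 hgy
  exact hstep hgy hz hgz hy

lemma isEven_singleton_of_isLoopAt (h : G.IsLoopAt g x) : IsEven G.IsNonloopAt {g} := fun y => by
  rw [boundary_singleton, if_neg (h.not_isNonloopAt y)]

lemma deg_ofEdges_singleton (h : G.IsLoopAt g x) : (ofEdges G {g}).deg x = 2 := by
  have hinc : (ofEdges G {g}).incidenceSet x = {g} := by
    ext k
    simp only [mem_incidenceSet, ofEdges_inc, Finset.mem_singleton, Set.mem_singleton_iff,
      and_iff_left_iff_imp]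
    exact fun hk => hk ▸ h.inc
  have hloop : (ofEdges G {g}).loopSet x = {g} := by
    ext k
    simp only [mem_loopSet, ofEdges_isLoopAt, Finset.mem_singleton, Set.mem_singleton_iff,
      and_iff_left_iff_imp]
    exact fun hk => hk ▸ h
  rw [deg, hinc, hloop, Set.encard_singleton, one_add_one_eq_two]

lemma IsClaw.deg_ofEdges {a c : β} (h : IsClaw G.IsNonloopAt x a b c)
    (hF : IsEven G.IsNonloopAt F) (ha : a ∈ F) (hloop : ∀ g ∈ F, ¬ G.IsLoopAt g x) :
    (ofEdges G F).deg x = 2 := by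
  have hempty : (ofEdges G F).loopSet x = ∅ :=
    Set.eq_empty_of_forall_notMem fun g hg => hloop g (ofEdges_isLoopAt.1 hg).1
      (ofEdges_isLoopAt.1 hg).2
  have hmem (g : β) : g ∈ (ofEdges G F).incidenceSet x ↔ g ∈ F ∧ (g = a ∨ g = b ∨ g = c) := by
    rw [mem_incidenceSet, ofEdges_inc, ← h.inc_iff, inc_iff_isNonloopAt_or_isLoopAt]
    exact and_congr_right fun hg => or_iff_left (hloop g hg)
  have hbc : b ∈ F ↔ c ∉ F := (h.boundary_eq_zero_iff.1 (hF x)).1 ha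
  obtain ⟨k, hak, hset⟩ : ∃ k, a ≠ k ∧ (ofEdges G F).incidenceSet x = {a, k} := by
    by_cases hb : b ∈ F
    · refine ⟨b, h.ne₁₂, Set.ext fun g => ?_⟩
      rw [hmem, Set.mem_insert_iff, Set.mem_singleton_iff]
      grind
    · refine ⟨c, h.ne₁₃, Set.ext fun g => ?_⟩
      rw [hmem, Set.mem_insert_iff, Set.mem_singleton_iff]
      grind
  rw [deg, hset, hempty, Set.encard_pair hak, Set.encard_empty, add_zero]

lemma deg_ofEdges (hdeg : G.deg x = 3) (hF : IsCircuitSet G.IsNonloopAt F) (hg : g ∈ F)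
    (hgx : G.Inc g x) : (ofEdges G F).deg x = 2 := by
  by_cases hloop : ∃ l ∈ F, G.IsLoopAt l x
  · obtain ⟨l, hlF, hl⟩ := hloop
    obtain rfl := hF.eq_of_le ⟨Finset.singleton_nonempty l, isEven_singleton_of_isLoopAt hl⟩
      (Finset.singleton_subset_iff.2 hlF)
    exact deg_ofEdges_singleton hl
  push Not at hloop
  have hgx' := hgx.isLoopAt_or_isNonloopAt.resolve_left (hloop g hg)
  by_cases hx : ∃ l, G.IsLoopAt l x
  · obtain ⟨l, hl⟩ := hx
    obtain ⟨b, hb⟩ := exists_isNonloopAt_iff_eq_of_deg_eq_three hdeg hl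
    exact absurd ((hb g).1 hgx' ▸ hg) (notMem_of_isEven_of_inc_iff_eq hF.prop.2 hb)
  · obtain ⟨a, b, c, hclaw⟩ := exists_isClaw_of_deg_eq_three hdeg (not_exists.1 hx)
    obtain ⟨b, c, hclaw⟩ := hclaw.exists_of_inc hgx'
    exact hclaw.deg_ofEdges hF.prop.2 hg hloop

lemma isCircuit_ofEdges (hcubic : G.IsCubic) (hF : ↑F ⊆ G.edgeSet)
    (hcircuit : IsCircuitSet G.IsNonloopAt F) : (ofEdges G F).IsCircuit := by
  refine ⟨?_, isConnected_ofEdges hF hcircuit, ?_⟩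
  · have hends (g : β) (hg : g ∈ F) : {x | G.Inc g x}.Finite := by
      obtain ⟨x, y, hxy⟩ := exists_isLink_of_mem_edgeSet (hF hg)
      exact (Set.toFinite {x, y}).subset fun z hz => Inc.eq_or_eq_of_isLink hz hxy
    exact (F.finite_toSet.biUnion hends).subset fun x ⟨g, hg, hgx⟩ => Set.mem_biUnion hg hgx
  · rintro x ⟨g, hg, hgx⟩
    exact deg_ofEdges (hcubic x hgx.vertex_mem) hcircuit hg hgx

lemma card_covers_le_nu (hcubic : G.IsCubic) {E : Finset β} (hE : ↑E = G.edgeSet) :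
    ((covers G.IsNonloopAt E).card : ℕ∞) ≤ G.nu := by
  rw [← Set.encard_coe_eq_coe_finsetCard]
  have hsub {D : Finset (Finset β)} (hD : D ∈ covers G.IsNonloopAt E) :
      ∀ F ∈ D, ↑F ⊆ G.edgeSet :=
    fun F hF => hE ▸ ((mem_covers.1 hD).1 F hF).1
  have hinj : Set.InjOn (ofEdges G) {F | ↑F ⊆ G.edgeSet} := fun F hF F' hF' heq => by
    rw [← edgeFinset_ofEdges hF, heq, edgeFinset_ofEdges hF']
  refine Set.encard_le_encard_of_injOn (f := fun D => D.val.map (ofEdges G)) (fun D hD => ?_)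
    fun D hD D' hD' heq =>
      Finset.val_injective (injOn_multiset_map hinj (hsub hD) (hsub hD') heq)
  have hcover := mem_covers.1 hD
  refine ⟨fun C hC => ?_, fun g hg => ?_⟩
  · obtain ⟨F, hF, rfl⟩ := Multiset.mem_map.1 hC
    exact ⟨ofEdges_le G F, isCircuit_ofEdges hcubic (hsub hD F hF) (hcover.1 F hF).2⟩
  · rw [Multiset.countP_map, ← Multiset.countP_eq_card_filter, ← hcover.2 g (hE ▸ hg)]
    exact Multiset.countP_congr rfl fun F hF => by rw [edgeSet_ofEdges (hsub hD F hF)]; rfl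

end OfEdges

/-! ### Chords and loops -/

section EvenSubsets

variable {α β : Type*} {I : β → α → Prop} {F F' E : Finset β} {Y : Finset α} {x y : α}

lemma boundary_symmDiff :
    boundary I (symmDiff F F') x = boundary I F x + boundary I F' x := by
  have hcancel : ∀ a b c : ZMod 2, a + c + (b + c) = a + b := by decide
  rw [symmDiff_def, Finset.sup_eq_union, boundary_union disjoint_sdiff_sdiff,
    ← Finset.sdiff_inter_self_left F F', boundary_sdiff Finset.inter_subset_left,
    ← Finset.sdiff_inter_self_left F' F, boundary_sdiff Finset.inter_subset_left,
    Finset.inter_comm F' F, hcancel]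

lemma isEven_symmDiff_of_boundary_eq_one_iff
    (h : ∀ x, boundary I F x = 1 ↔ boundary I F' x = 1) : IsEven I (symmDiff F F') := by
  intro x
  have hadd : ∀ a b : ZMod 2, (a = 1 ↔ b = 1) → a + b = 0 := by decide
  rw [boundary_symmDiff, hadd _ _ (h x)]

lemma filter_boundary_eq_one_ne_singleton (hF : ∀ g ∈ F, HasEnds I g)
    (hFY : ∀ x, boundary I F x = 1 → x ∈ Y) : (Y.filter fun x => boundary I F x = 1) ≠ {y} := by
  intro hsingle
  have hiff (x : α) : boundary I F x = 1 ↔ x = y := by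
    have hmem := Finset.ext_iff.1 hsingle x
    rw [Finset.mem_filter, Finset.mem_singleton] at hmem
    exact ⟨fun h => hmem.1 ⟨hFY x h, h⟩, fun h => (hmem.2 h).2⟩
  obtain ⟨z, hzy, hz, -⟩ := exists_path_of_boundary_eq_one hF ((hiff y).2 rfl)
  exact hzy ((hiff z).1 hz)

-- Pigeonhole: the boundary of a subset of `E` is a subset of `Y` that is never a singleton.
lemma exists_isEven_of_card_le (hY : Y.Nonempty) (hE : ∀ g ∈ E, HasEnds I g)
    (hEY : ∀ g ∈ E, ∀ x, I g x → x ∈ Y) (hcard : Y.card ≤ E.card) :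
    ∃ F ⊆ E, F.Nonempty ∧ IsEven I F := by
  obtain ⟨y, hy⟩ := hY
  have hsupport {F : Finset β} (hF : F ∈ E.powerset) (x : α) (hx : boundary I F x = 1) :
      x ∈ Y := by
    by_contra hxY
    refine zero_ne_one (hx ▸ boundary_eq_zero_of_forall_not fun g hg hgx => hxY ?_).symm
    exact hEY g (Finset.mem_powerset.1 hF hg) x hgx
  have hlt : (Y.powerset.erase {y}).card < E.powerset.card := by
    rw [Finset.card_powerset]
    refine (Finset.card_erase_lt_of_mem (by simpa using hy)).trans_le ?_
    rw [Finset.card_powerset]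
    exact Nat.pow_le_pow_right two_pos hcard
  obtain ⟨F, hF, F', hF', hne, heq⟩ := Finset.exists_ne_map_eq_of_card_lt_of_maps_to hlt
    (f := fun F => Y.filter fun x => boundary I F x = 1) fun F hF => Finset.mem_erase.2
      ⟨filter_boundary_eq_one_ne_singleton (fun g hg => hE g (Finset.mem_powerset.1 hF hg))
        (hsupport hF), Finset.mem_powerset.2 (Finset.filter_subset _ _)⟩
  refine ⟨symmDiff F F', ?_, Finset.symmDiff_nonempty.2 hne,
    isEven_symmDiff_of_boundary_eq_one_iff fun x => ?_⟩
  · exact (symmDiff_le_sup (a := F) (b := F')).trans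
      (sup_le (Finset.mem_powerset.1 hF) (Finset.mem_powerset.1 hF'))
  · have hiff := Finset.ext_iff.1 heq x
    simp only [Finset.mem_filter] at hiff
    exact ⟨fun h => (hiff.1 ⟨hsupport hF x h, h⟩).2, fun h => (hiff.2 ⟨hsupport hF' x h, h⟩).2⟩

lemma three_mul_card_le {A K : Finset β} (hY : ∀ x ∈ Y, 3 ≤ ((A ∪ K).filter (I · x)).card)
    (hA : ∀ g ∈ A, (Y.filter (I g)).card ≤ 2) (hK : ∀ g ∈ K, (Y.filter (I g)).card ≤ 1) :
    3 * Y.card ≤ 2 * A.card + K.card := by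
  calc 3 * Y.card = ∑ _x ∈ Y, 3 := by rw [Finset.sum_const, smul_eq_mul, mul_comm]
    _ ≤ ∑ x ∈ Y, ((A ∪ K).filter (I · x)).card := Finset.sum_le_sum hY
    _ = ∑ g ∈ A ∪ K, (Y.filter (I g)).card :=
      (Finset.sum_card_bipartiteAbove_eq_sum_card_bipartiteBelow I).symm
    _ ≤ ∑ g ∈ A, (Y.filter (I g)).card + ∑ g ∈ K, (Y.filter (I g)).card := by
      rw [← Finset.sum_union_inter]; exact Nat.le_add_right _ _
    _ ≤ ∑ _g ∈ A, 2 + ∑ _g ∈ K, 1 := Nat.add_le_add (Finset.sum_le_sum hA) (Finset.sum_le_sum hK)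
    _ = 2 * A.card + K.card := by
      simp only [Finset.sum_const, smul_eq_mul, mul_one, mul_comm]

lemma IsClaw.card_filter_eq_three {a b c : β} (h : IsClaw I x a b c) (ha : a ∈ F) (hb : b ∈ F)
    (hc : c ∈ F) : (F.filter (I · x)).card = 3 := by
  refine Finset.card_eq_three.2 ⟨a, b, c, h.ne₁₂, h.ne₁₃, h.ne₂₃, ?_⟩
  ext g
  simp only [Finset.mem_filter, h.inc_iff, Finset.mem_insert, Finset.mem_singleton,
    and_iff_right_iff_imp]
  rintro (rfl | rfl | rfl) <;> assumption

end EvenSubsets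

section EdgeCut

variable {α β : Type*} {G : Graph α β} {X : Set α} {F : Finset β} {x y : α} {g : β}

lemma hasEnds_of_isLink (h : G.IsLink g x y) (hxy : x ≠ y) : HasEnds G.IsNonloopAt g :=
  ⟨x, y, hxy, fun _ => isNonloopAt_iff_of_isLink h hxy⟩

lemma exists_isCircuit_induce (hcubic : G.IsCubic) (hFE : ↑F ⊆ G.edgeSet) (hne : F.Nonempty)
    (hF : IsEven G.IsNonloopAt F) (hFX : ∀ g ∈ F, ∀ x, G.Inc g x → x ∈ X) :
    ∃ C, C ≤ G.induce X ∧ C.IsCircuit := by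
  obtain ⟨C, hCF, hC⟩ := exists_minimal_le_of_wellFoundedLT
    (fun F => F.Nonempty ∧ IsEven G.IsNonloopAt F) F ⟨hne, hF⟩
  refine ⟨ofEdges G C, ⟨?_, fun g x y hlink => ?_⟩,
    isCircuit_ofEdges hcubic ((Finset.coe_subset.2 hCF).trans hFE) hC⟩
  · rintro x ⟨g, hg, hgx⟩
    exact hFX g (hCF hg) x hgx
  · obtain ⟨hg, hlink⟩ := ofEdges_isLink.1 hlink
    exact ⟨hlink, hFX g (hCF hg) x hlink.inc_left, hFX g (hCF hg) y hlink.inc_right⟩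

lemma mem_edgeCut_or_forall_inc (hgx : G.Inc g x) (hx : x ∉ X) :
    g ∈ G.edgeCut X ∨ ∀ z, G.Inc g z → z ∈ G.vertexSet \ X := by
  obtain ⟨y, hxy⟩ := hgx
  by_cases hy : y ∈ X
  · exact .inl ⟨y, hy, x, ⟨hxy.left_mem, hx⟩, hxy.symm⟩
  · refine .inr fun z hz => ⟨hz.vertex_mem, ?_⟩
    rcases hz.eq_or_eq_of_isLink hxy with rfl | rfl <;> assumption

lemma three_mul_card_le_of_edgeCut (hcubic : G.IsCubic) {Y : Finset α} {A K : Finset β}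
    (hY : ↑Y = G.vertexSet \ X) (hK : ↑K = G.edgeCut X)
    (hA : ∀ g, g ∈ A ↔ g ∈ G.edgeSet ∧ ∀ x, G.Inc g x → x ∈ Y)
    (hloop : ∀ x ∈ Y, ∀ g, ¬ G.IsLoopAt g x) : 3 * Y.card ≤ 2 * A.card + K.card := by
  have hmemY (x : α) : x ∈ Y ↔ x ∈ G.vertexSet \ X := by rw [← hY, Finset.mem_coe]
  have hmemK (g : β) : g ∈ K ↔ g ∈ G.edgeCut X := by rw [← hK, Finset.mem_coe]
  refine three_mul_card_le (I := G.IsNonloopAt) (fun x hx => ?_) (fun g hg => ?_) fun g hg => ?_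
  · obtain ⟨hxV, hxX⟩ := (hmemY x).1 hx
    obtain ⟨a, b, c, hclaw⟩ := exists_isClaw_of_deg_eq_three (hcubic x hxV) (hloop x hx)
    have hmem {g : β} (hg : g = a ∨ g = b ∨ g = c) : g ∈ A ∪ K := by
      have hgx := (hclaw.inc_iff g).2 hg
      rw [Finset.mem_union, hA, hmemK, or_comm]
      refine (mem_edgeCut_or_forall_inc hgx.inc hxX).imp_right fun h => ⟨hgx.edge_mem, ?_⟩
      exact fun z hz => (hmemY z).2 (h z hz)
    exact (hclaw.card_filter_eq_three (hmem (.inl rfl)) (hmem (.inr (.inl rfl)))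
      (hmem (.inr (.inr rfl)))).ge
  · obtain ⟨a, b, hab⟩ := exists_isLink_of_mem_edgeSet ((hA g).1 hg).1
    refine (Finset.card_le_card fun z hz => ?_).trans (Finset.card_le_two (a := a) (b := b))
    simpa using (Finset.mem_filter.1 hz).2.inc.eq_or_eq_of_isLink hab
  · obtain ⟨a, ha, b, -, hab⟩ := (hmemK g).1 hg
    refine (Finset.card_le_card fun z hz => ?_).trans (Finset.card_singleton b).le
    obtain ⟨hzY, hz⟩ := Finset.mem_filter.1 hz
    refine Finset.mem_singleton.2 ((hz.inc.eq_or_eq_of_isLink hab).resolve_left ?_)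
    rintro rfl
    exact ((hmemY z).1 hzY).2 ha

lemma exists_isCircuit_induce_of_isLoopAt (hcubic : G.IsCubic) (hg : G.IsLoopAt g x)
    (hx : x ∈ X) : ∃ C, C ≤ G.induce X ∧ C.IsCircuit := by
  refine exists_isCircuit_induce hcubic (F := {g}) ?_ (Finset.singleton_nonempty g)
    (isEven_singleton_of_isLoopAt hg) ?_
  · simpa using hg.edge_mem
  · intro k hk z hz
    rw [Finset.mem_singleton.1 hk] at hz
    exact hg.eq_of_inc hz ▸ hx

lemma exists_isCircuit_induce_of_encard_edgeCut_le_two (hfin : G.vertexSet.Finite)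
    (hcubic : G.IsCubic) (hne : (G.vertexSet \ X).Nonempty)
    (hcut : (G.edgeCut X).encard ≤ 2) :
    ∃ C, C ≤ G.induce (G.vertexSet \ X) ∧ C.IsCircuit := by
  by_cases hloop : ∃ x ∈ G.vertexSet \ X, ∃ g, G.IsLoopAt g x
  · obtain ⟨x, hx, g, hg⟩ := hloop
    exact exists_isCircuit_induce_of_isLoopAt hcubic hg hx
  push Not at hloop
  have hEfin : G.edgeSet.Finite :=
    finite_edgeSet hfin fun x hx => by rw [hcubic x hx]; exact ENat.natCast_ne_top 3
  obtain ⟨Y, hY⟩ := (hfin.subset Set.sdiff_subset : (G.vertexSet \ X).Finite).exists_finset_coe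
  obtain ⟨K, hK⟩ := (Set.finite_of_encard_le_coe hcut).exists_finset_coe
  set A := hEfin.toFinset.filter fun g => ∀ x, G.Inc g x → x ∈ Y
  have hA (g : β) : g ∈ A ↔ g ∈ G.edgeSet ∧ ∀ x, G.Inc g x → x ∈ Y := by
    rw [Finset.mem_filter, Set.Finite.mem_toFinset]
  rw [← hY] at hne hloop ⊢
  have hKcard : K.card ≤ 2 := by
    rw [← hK, Set.encard_coe_eq_coe_finsetCard] at hcut
    exact_mod_cast hcut
  have hcount := three_mul_card_le_of_edgeCut hcubic hY hK hA hloop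
  have hends (g : β) (hg : g ∈ A) : HasEnds G.IsNonloopAt g := by
    obtain ⟨hgE, hgY⟩ := (hA g).1 hg
    obtain ⟨x, y, hxy⟩ := exists_isLink_of_mem_edgeSet hgE
    refine hasEnds_of_isLink hxy ?_
    rintro rfl
    exact hloop x (hgY x hxy.inc_left) g hxy
  obtain ⟨F, hFA, hFne, hF⟩ := exists_isEven_of_card_le hne hends
    (fun g hg x hx => ((hA g).1 hg).2 x hx.inc) (by have := Finset.card_pos.2 hne; lia)
  exact exists_isCircuit_induce hcubic (fun g hg => ((hA g).1 (hFA hg)).1) hFne hF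
    fun g hg => ((hA g).1 (hFA hg)).2

end EdgeCut

section FourCycle

variable {α β : Type*} {G : Graph α β} {v : Fin 4 → α} {e f : Fin 4 → β} {x y : α} {g : β}

lemma isNonloopAt_edge_iff (h : G.IsFourCycle v e) (i : Fin 4) :
    G.IsNonloopAt (e i) x ↔ x = v i ∨ x = v (i + 1) :=
  isNonloopAt_iff_of_isLink (h.2 i) (h.1.ne (by simp))

lemma edge_injective (h : G.IsFourCycle v e) : Function.Injective e := by
  intro i j hij
  rcases (hij ▸ h.2 i).eq_and_eq_or_eq_and_eq (h.2 j) with ⟨hv, -⟩ | ⟨hv, hv'⟩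
  · exact h.1 hv
  · have hmod : ∀ i j : Fin 4, i = j + 1 → i + 1 = j → i = j := by decide
    exact hmod i j (h.1 hv) (h.1 hv')

lemma exists_third_edge (hcubic : G.IsCubic) (h : G.IsFourCycle v e) (i : Fin 4) :
    ∃ f, IsClaw G.IsNonloopAt (v i) (e i) (e (i - 1)) f := by
  have hsucc : G.IsNonloopAt (e i) (v i) := (isNonloopAt_edge_iff h i).2 (.inl rfl)
  have hpred : G.IsNonloopAt (e (i - 1)) (v i) :=
    (isNonloopAt_edge_iff h (i - 1)).2 (.inr (by rw [sub_add_cancel]))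
  have hne : e i ≠ e (i - 1) := (edge_injective h).ne (by lia)
  have hdeg := hcubic (v i) (h.2 i).left_mem
  by_cases hloop : ∃ g, G.IsLoopAt g (v i)
  · obtain ⟨g, hg⟩ := hloop
    obtain ⟨b, hb⟩ := exists_isNonloopAt_iff_eq_of_deg_eq_three hdeg hg
    exact absurd (((hb _).1 hsucc).trans ((hb _).1 hpred).symm) hne
  · obtain ⟨a, b, c, hclaw⟩ := exists_isClaw_of_deg_eq_three hdeg (not_exists.1 hloop)
    obtain ⟨b, c, hclaw⟩ := hclaw.exists_of_inc hsucc
    rcases (hclaw.inc_iff _).1 hpred with heq | rfl | rfl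
    · exact absurd heq.symm hne
    · exact ⟨c, hclaw⟩
    · exact ⟨b, hclaw.swap⟩

lemma third_edge_notMem_range (h : G.IsFourCycle v e)
    (hf : ∀ i, IsClaw G.IsNonloopAt (v i) (e i) (e (i - 1)) (f i)) (i : Fin 4) :
    f i ∉ Set.range e := by
  rintro ⟨k, hk⟩
  have hfi : G.IsNonloopAt (e k) (v i) := ((hf i).inc_iff _).2 (.inr (.inr hk))
  rcases (isNonloopAt_edge_iff h k).1 hfi with hv | hv
  · obtain rfl := h.1 hv
    exact (hf i).ne₁₃ hk
  · obtain rfl := h.1 hv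
    exact (hf (k + 1)).ne₂₃ (by rw [add_sub_cancel_right, hk])

lemma third_edge_injective (h : G.IsFourCycle v e)
    (hf : ∀ i, IsClaw G.IsNonloopAt (v i) (e i) (e (i - 1)) (f i))
    (hchord : ∀ g i j, G.IsLink g (v i) (v j) → g ∈ Set.range e) : Function.Injective f := by
  intro i j hij
  by_contra hne
  obtain ⟨w, hw, hlink⟩ := ((hf i).inc_iff (f i)).2 (.inr (.inr rfl))
  have hj : G.IsNonloopAt (f i) (v j) := ((hf j).inc_iff _).2 (.inr (.inr hij))
  obtain rfl := (hj.inc.eq_or_eq_of_isLink hlink).resolve_left (h.1.ne (Ne.symm hne))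
  exact third_edge_notMem_range h hf i (hchord _ _ _ hlink)

lemma mem_range_of_isLink_edge (h : G.IsFourCycle v e) {i : Fin 4} (hxy : G.IsLink (e i) x y) :
    y ∈ Set.range v := by
  rcases hxy.right_eq_or_eq (h.2 i) with rfl | rfl <;> exact ⟨_, rfl⟩

lemma isEven_image_edge (h : G.IsFourCycle v e) :
    IsEven G.IsNonloopAt (Finset.univ.image e) := by
  intro x
  rw [boundary, Finset.sum_image fun i _ j _ hij => edge_injective h hij]
  simp only [isNonloopAt_edge_iff h]
  by_cases hx : x ∈ Set.range v
  · obtain ⟨j, rfl⟩ := hx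
    simp only [h.1.eq_iff]
    revert j
    decide
  · refine Finset.sum_eq_zero fun i _ => if_neg ?_
    rintro (rfl | rfl) <;> exact hx ⟨_, rfl⟩

lemma exists_isCircuit_induce_range (hcubic : G.IsCubic) (h : G.IsFourCycle v e) :
    ∃ C, C ≤ G.induce (Set.range v) ∧ C.IsCircuit := by
  refine exists_isCircuit_induce hcubic (F := Finset.univ.image e) ?_ (by simp)
    (isEven_image_edge h) fun g hg x hgx => ?_
  · intro g hg
    obtain ⟨i, -, rfl⟩ := Finset.mem_image.1 hg
    exact (h.2 i).edge_mem
  · obtain ⟨i, -, rfl⟩ := Finset.mem_image.1 hg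
    exact mem_range_of_isLink_edge h hgx.choose_spec.symm

lemma encard_edgeCut_range_le_two (h : G.IsFourCycle v e)
    (hf : ∀ i, IsClaw G.IsNonloopAt (v i) (e i) (e (i - 1)) (f i)) {i j : Fin 4} (hij : i ≠ j)
    (hlink : G.IsLink g (v i) (v j)) (hg : g ∉ Set.range e) :
    (G.edgeCut (Set.range v)).encard ≤ 2 := by
  have hthird {k : Fin 4} {g : β} (hgk : G.IsNonloopAt g (v k)) (hg : g ∉ Set.range e) :
      g = f k := by
    rcases ((hf k).inc_iff g).1 hgk with rfl | rfl | hgf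
    exacts [absurd ⟨_, rfl⟩ hg, absurd ⟨_, rfl⟩ hg, hgf]
  have hnonloop (k : Fin 4) := isNonloopAt_iff_of_isLink (z := v k) hlink (h.1.ne hij)
  have hgi : g = f i := hthird ((hnonloop i).2 (.inl rfl)) hg
  have hgj : g = f j := hthird ((hnonloop j).2 (.inr rfl)) hg
  have hcut : G.edgeCut (Set.range v) ⊆ ↑(({i, j}ᶜ : Finset (Fin 4)).image f) := by
    rintro k ⟨_, ⟨l, rfl⟩, y, ⟨-, hy⟩, hly⟩
    have hke : k ∉ Set.range e := by
      rintro ⟨m, rfl⟩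
      exact hy (mem_range_of_isLink_edge h hly)
    have hkl : k = f l := hthird ⟨y, fun hyl => hy ⟨l, hyl.symm⟩, hly⟩ hke
    have hkg : k ≠ g := by
      rintro rfl
      rcases hly.right_eq_or_eq hlink with rfl | rfl <;> exact hy ⟨_, rfl⟩
    refine Finset.mem_coe.2 (Finset.mem_image.2 ⟨l, ?_, hkl.symm⟩)
    rw [Finset.mem_compl, Finset.mem_insert, Finset.mem_singleton]
    rintro (rfl | rfl)
    exacts [hkg (hkl.trans hgi.symm), hkg (hkl.trans hgj.symm)]
  refine (Set.encard_le_encard hcut).trans ?_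
  rw [Set.encard_coe_eq_coe_finsetCard]
  refine (Nat.cast_le.2 Finset.card_image_le).trans ?_
  rw [Finset.card_compl, Finset.card_pair hij, Fintype.card_fin]
  rfl

lemma notMem_range_of_isLoopAt (hcubic : G.IsCubic) (h : G.IsFourCycle v e)
    (hg : G.IsLoopAt g x) : x ∉ Set.range v := by
  rintro ⟨i, rfl⟩
  obtain ⟨b, hb⟩ :=
    exists_isNonloopAt_iff_eq_of_deg_eq_three (hcubic (v i) (h.2 i).left_mem) hg
  obtain ⟨f, hf⟩ := exists_third_edge hcubic h i
  exact hf.ne₁₂ (((hb _).1 ((hf.inc_iff _).2 (.inl rfl))).trans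
    ((hb _).1 ((hf.inc_iff _).2 (.inr (.inl rfl)))).symm)

-- A chord would leave at most two edges in the cut around the 4-cycle, so that the other side
-- of the cut contains a circuit as well.
lemma mem_range_of_isLink_of_isCyclicallyEdgeConnected (hfin : G.vertexSet.Finite)
    (hcubic : G.IsCubic) (hconn : G.IsCyclicallyEdgeConnected 4)
    (hcard : G.vertexSet.ncard ≠ 4) (h : G.IsFourCycle v e) {i j : Fin 4}
    (hlink : G.IsLink g (v i) (v j)) : g ∈ Set.range e := by
  by_contra hg
  choose f hf using exists_third_edge hcubic h
  have hij : i ≠ j := by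
    rintro rfl
    exact notMem_range_of_isLoopAt hcubic h hlink ⟨i, rfl⟩
  have hcut := encard_edgeCut_range_le_two h hf hij hlink hg
  have hsub : Set.range v ⊆ G.vertexSet := by
    rintro _ ⟨k, rfl⟩
    exact (h.2 k).left_mem
  have hne : (G.vertexSet \ Set.range v).Nonempty := by
    rw [Set.sdiff_nonempty]
    intro hsup
    rw [hsup.antisymm hsub, Set.ncard_range_of_injective h.1, Nat.card_fin] at hcard
    exact hcard rfl
  have hfour := hconn _ hsub (exists_isCircuit_induce_range hcubic h)
    (exists_isCircuit_induce_of_encard_edgeCut_le_two hfin hcubic hne hcut)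
  exact absurd (hfour.trans hcut) (by decide)

lemma exists_square (hcubic : G.IsCubic) (h : G.IsFourCycle v e)
    (hchord : ∀ g i j, G.IsLink g (v i) (v j) → g ∈ Set.range e)
    (hloop : ∀ g x, ¬ G.IsLoopAt g x) {E : Finset β} (hE : ↑E = G.edgeSet) :
    ∃ S : Square G.IsNonloopAt E, S.e = e := by
  choose f hf using exists_third_edge hcubic h
  refine ⟨⟨v, e, f, h.1, third_edge_injective h hf hchord, hf, fun x _ => ?_, fun g hg => ?_,
    fun g x hg => ?_⟩, rfl⟩
  · by_cases hx : x ∈ G.vertexSet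
    · exact .inr (exists_isClaw_of_deg_eq_three (hcubic x hx) fun g => hloop g x)
    · exact .inl fun g hg => hx hg.vertex_mem
  · rw [← Finset.mem_coe, hE] at hg
    obtain ⟨x, y, hxy⟩ := exists_isLink_of_mem_edgeSet hg
    refine hasEnds_of_isLink hxy ?_
    rintro rfl
    exact hloop g x hxy
  · rw [← Finset.mem_coe, hE]
    exact hg.edge_mem

variable {H : Graph α β} {S : Set β}

lemma deleteEdges_isNonloopAt (hg : g ∉ S) :
    (G.deleteEdges S).IsNonloopAt g x ↔ G.IsNonloopAt g x := by
  simp only [isNonloopAt_iff_inc_not_isLoopAt, deleteEdges_inc, deleteEdges_isLoopAt, hg,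
    not_false_eq_true, and_true]

lemma IsDoubleCover.of_deleteEdges {D : Multiset (Finset β)}
    (hD : IsDoubleCover (G.deleteEdges S).IsNonloopAt (G.deleteEdges S).edgeSet D) :
    IsDoubleCover G.IsNonloopAt (G.edgeSet \ S) D := by
  rw [edgeSet_deleteEdges] at hD
  refine ⟨fun F hF => ⟨(hD.1 F hF).1, ?_⟩, hD.2⟩
  rw [← isCircuitSet_congr fun g hg x => deleteEdges_isNonloopAt ((hD.1 F hF).1 hg).2]
  exact (hD.1 F hF).2

lemma nu_le_encard_of_isSuppressionOf_deleteEdges (h : H.IsSuppressionOf (G.deleteEdges S)) :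
    H.nu ≤ {D | IsDoubleCover G.IsNonloopAt (G.edgeSet \ S) D}.encard :=
  (nu_le_encard_of_isSuppressionOf h).trans
    (Set.encard_le_encard fun _ hD => IsDoubleCover.of_deleteEdges hD)

-- The edge of `G` joining the vertex of a loop to the rest of `G` lies in no even set.
lemma nu_eq_zero_of_isLoopAt (hcubic : G.IsCubic) (hcycle : G.IsFourCycle v e)
    (hg : G.IsLoopAt g x) (hS : S ⊆ Set.range e) (h : H.IsSuppressionOf (G.deleteEdges S)) :
    H.nu = 0 := by
  obtain ⟨b, hb⟩ := exists_isNonloopAt_iff_eq_of_deg_eq_three (hcubic x hg.vertex_mem) hg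
  have hbx : G.IsNonloopAt b x := (hb b).2 rfl
  have hbS : b ∉ S := by
    intro hbS
    obtain ⟨i, rfl⟩ := hS hbS
    exact notMem_range_of_isLoopAt hcubic hcycle hg
      (mem_range_of_isLink_edge hcycle hbx.inc.choose_spec.symm)
  refine le_antisymm ((nu_le_encard_of_isSuppressionOf_deleteEdges h).trans ?_) zero_le
  refine (Set.encard_eq_zero.2 (Set.eq_empty_of_forall_notMem fun D hD => ?_)).le
  have hcount : D.countP (b ∈ ·) = 2 := hD.2 b ⟨hbx.edge_mem, hbS⟩
  obtain ⟨F, hF, hbF⟩ := Multiset.countP_pos.1 (hcount ▸ two_pos)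
  exact notMem_of_isEven_of_inc_iff_eq (hD.isEven F hF) hb hbF

end FourCycle

end CycleSpace

end

open Graph CycleSpace

theorem theorem6p2_general {α β : Type*} {G G₁ G₂ : Graph α β} (hfin : G.vertexSet.Finite)
    (hcubic : G.IsCubic) {v : Fin 4 → α} {e : Fin 4 → β} (hcycle : G.IsFourCycle v e)
    (hchord : ∀ g i j, G.IsLink g (v i) (v j) → g ∈ Set.range e)
    (h₁ : G₁.IsSuppressionOf (G.deleteEdges {e 0, e 2}))
    (h₂ : G₂.IsSuppressionOf (G.deleteEdges {e 1, e 3})) :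
    2 * (G₁.nu + G₂.nu) ≤ G.nu := by
  classical
  have hpair (i j : Fin 4) : {e i, e j} ⊆ Set.range e := Set.pair_subset ⟨i, rfl⟩ ⟨j, rfl⟩
  by_cases hloop : ∃ g x, G.IsLoopAt g x
  · obtain ⟨g, x, hg⟩ := hloop
    rw [nu_eq_zero_of_isLoopAt hcubic hcycle hg (hpair 0 2) h₁,
      nu_eq_zero_of_isLoopAt hcubic hcycle hg (hpair 1 3) h₂]
    simp
  push Not at hloop
  obtain ⟨E, hE⟩ := (finite_edgeSet hfin fun x hx =>
    (hcubic x hx).trans_ne (ENat.natCast_ne_top 3)).exists_finset_coe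
  obtain ⟨S, rfl⟩ := exists_square hcubic hcycle hchord hloop hE
  have hkeep (r : Fin 4) : ↑(S.keeping r) = G.edgeSet \ {S.e (r + 1), S.e (r + 3)} := by
    simp [Square.keeping, hE]
  have hν₁ : G₁.nu ≤ (covers G.IsNonloopAt (S.keeping 1)).card := by
    refine (nu_le_encard_of_isSuppressionOf_deleteEdges h₁).trans ?_
    rw [Set.pair_comm]
    exact hkeep 1 ▸ S.encard_isDoubleCover_le 1
  have hν₂ : G₂.nu ≤ (covers G.IsNonloopAt (S.keeping 0)).card :=
    (nu_le_encard_of_isSuppressionOf_deleteEdges h₂).trans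
      (hkeep 0 ▸ S.encard_isDoubleCover_le 0)
  calc 2 * (G₁.nu + G₂.nu)
    _ ≤ 2 * ((covers G.IsNonloopAt (S.keeping 1)).card +
          (covers G.IsNonloopAt (S.keeping 0)).card : ℕ∞) := by gcongr
    _ ≤ (covers G.IsNonloopAt E).card := by
      rw [add_comm, mul_add]
      exact_mod_cast S.card_covers_le
    _ ≤ G.nu := card_covers_le_nu hcubic hE

theorem theorem6p2 {α β : Type*} (G G₁ G₂ : Graph α β)
    (hfin : G.vertexSet.Finite) (hcubic : G.IsCubic)
    (hconn : G.IsCyclicallyEdgeConnected 4)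
    -- the only graph excluded here is the complete graph on four vertices
    (hK4 : G.vertexSet.ncard ≠ 4)
    (v : Fin 4 → α) (e : Fin 4 → β) (hcycle : G.IsFourCycle v e)
    (h₁ : G₁.IsSuppressionOf (G.deleteEdges {e 0, e 2}))
    (h₂ : G₂.IsSuppressionOf (G.deleteEdges {e 1, e 3})) :
    4 * min G₁.nu G₂.nu ≤ G.nu := by
  have hchord (g : β) (i j : Fin 4) (hg : G.IsLink g (v i) (v j)) : g ∈ Set.range e :=
    mem_range_of_isLink_of_isCyclicallyEdgeConnected hfin hcubic hconn hK4 hcycle hg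
  calc 4 * min G₁.nu G₂.nu = 2 * (min G₁.nu G₂.nu + min G₁.nu G₂.nu) := by
        rw [← two_mul, ← mul_assoc]; norm_num
    _ ≤ 2 * (G₁.nu + G₂.nu) := by gcongr <;> simp
    _ ≤ G.nu := theorem6p2_general hfin hcubic hcycle hchord h₁ h₂
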